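/- **Model.** Let $G$ be a connected undirected graph with $n\ge 2$ nodes and diameter $D$, and let $s$ be a source node that holds $k\ge 1$ messages. In each synchronous round every node either broadcasts one packet to all its neighbours or is silent. A node $v$ receives a packet in a round if and only if $v$ is silent, exactly one neighbour $u$ of $v$ broadcasts, and no fault occurs; otherwise it hears something that it recognises as not being a packet. In the *sender fault* model each broadcasting node fails (transmits noise), and in the *receiver fault* model each listening node with exactly one broadcasting neighbour fails (receives noise), in each round with probability $p\in[0,1)$, independently of everything else. A *coding schedule* fixes for every node $u$ and round $r$ a function that maps everything $u$ has heard before round $r$ (and, if $u=s$, the messages) to silence or to a packet, and for every node a decoding function. It broadcasts the $k$ messages in $T$ rounds with failure probability at most $\delta$ if, for all values of the messages, with probability at least $1-\delta$ every node other than $s$ decodes all $k$ messages correctly from what it heard in the first $T$ rounds. For constants $a,b$ let messages have $a\lceil\log_2(nk)\rceil$ bits and packets $b\lceil\log_2(nk)\rceil$ bits. The *coding throughput* of $(G,s)$ is $\tau^{NC}_{a,b}(G,s)=\limsup_{k\to\infty} k/L_k$, where $L_k$ is the least number of rounds in which some coding schedule broadcasts $k$ messages with failure probability at most $1/k$. **Decay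 with random linear network coding** over a finite field $F$, for messages in $F^l$: a packet is a pair in $F^k\times F^l$, consisting of a coefficient vector and the corresponding linear combination of the messages. A node at distance $d$ from $s$ is active in the rounds $r=0,1,2,\dots$ with $r\equiv d \pmod 3$. In an active round $r$ it broadcasts with probability $2^{-i}$, where $i=(\lfloor r/3\rfloor \bmod \lceil\log_2 n\rceil)+1$, independently of everything else and whether or not it has received anything yet. The packet that it broadcasts is a combination, with fresh independent uniformly random coefficients from $F$, of all packets it has received (the zero packet if there are none); the source combines the $k$ messages (with their unit coefficient vectors). A node decodes by solving the linear system given by the packets that it has received. **Statement.** Fix $p\in[0,1)$ and one of the two fault models. 1. For every finite field $F$ there is a constant $C$ (depending only on $p$, the fault model and $F$; so for $F=\mathbb F_2$ only on $p$ and the fault model) such that for all $G,s,k,l$ as above, all messages in $F^l$ and every $T\ge C\,(D\log n+k\log n+\log^2 n)$, Decay with random linear network coding delivers all $k$ messages to all nodes within $T$ rounds with probability at least $1-\frac1{\max(n,k)}$ over the faults and the random choices of the algorithm. 2. The same holds with packets of $O(\log(nk))$ bits, and every topology has coding throughput $\Omega(1/\log n)$. Precisely, there are constants $C,c>0$ depending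 only on $p$ and the fault model such that for every $a$ there is a $b$ for which, for all $G,s$ as above: * for every $k\ge 1$ there is a coding schedule of at most $C\,(D\log n+k\log n+\log^2 n)$ rounds, with messages of $a\lceil\log_2(nk)\rceil$ bits and packets of $b\lceil\log_2(nk)\rceil$ bits, that broadcasts $k$ messages with failure probability at most $\frac1{\max(n,k)}$; * $\tau^{NC}_{a,b}(G,s)\ge \dfrac{c}{\log n}$. -/

import Mathlib

open MeasureTheory ProbabilityTheory Filter
open scoped ENNReal

universe u

noncomputable section

namespace NoisyRadio

/-- Whether the random faults hit the broadcasting nodes or the listening nodes. -/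
inductive FaultModel
  | sender
  | receiver

/-- A (network) coding schedule for `k` messages. In round `r`, node `u` applies `act u r` to
what it knows: the `k` messages if it is the source (`some m` for the source, `none` for all other
nodes) and the list of everything it heard so far (one entry per past round, latest round first,
`none` for a round without a packet). The result is a packet to broadcast, or `none` for silence.
`decode u` is the rule by which `u` finally computes the messages from what it heard. -/
structure CodingSchedule (V : Type*) (k : ℕ) (Msg Pkt : Type*) where
  act : V → ℕ → Option (Fin k → Msg) → List (Option Pkt) → Option Pkt
  decode : V → List (Option Pkt) → Fin k → Msg

open Classical in
/-- What `v` hears in a round in which every node `u` broadcasts `tx u` (`none`: silent) and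
`fault u` says whether the fault at `u` occurs. The node `v` gets a packet iff it is silent, exactly
one of its neighbours broadcasts, and there is no fault (at that neighbour for sender faults, at `v`
for receiver faults). In all other cases it hears something that is not a packet. -/
def hear {V Pkt : Type*} (G : SimpleGraph V) (fm : FaultModel) (fault : V → Bool)
    (tx : V → Option Pkt) (v : V) : Option Pkt :=
  if h : tx v = none ∧ ∃! u, G.Adj v u ∧ tx u ≠ none then
    match fm with
    | .sender => if fault h.2.choose then none else tx h.2.choose
    | .receiver => if fault v then none else tx h.2.choose
  else none

open Classical in
/-- The list of everything each node heard in the first `r` rounds (latest round first), when the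
source `s` holds the messages `m` and the fault at node `u` in round `r` occurs iff
`fault r u = true`. -/
def history {V : Type*} {k : ℕ} {Msg Pkt : Type*} (G : SimpleGraph V) (s : V) (fm : FaultModel)
    (S : CodingSchedule V k Msg Pkt) (m : Fin k → Msg) (fault : ℕ → V → Bool) :
    ℕ → V → List (Option Pkt)
  | 0, _ => []
  | r + 1, v =>
    hear G fm (fault r)
      (fun u => S.act u r (if u = s then some m else none) (history G s fm S m fault r u)) v
      :: history G s fm S m fault r v

/-- After `T` rounds all nodes have all `k` messages. -/
def Solved {V : Type*} {k : ℕ} {Msg Pkt : Type*} (G : SimpleGraph V) (s : V) (fm : FaultModel)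
    (S : CodingSchedule V k Msg Pkt) (m : Fin k → Msg) (T : ℕ) (fault : ℕ → V → Bool) : Prop :=
  ∀ v, v ≠ s → S.decode v (history G s fm S m fault T v) = m

/-- Extend the faults of the first `T` rounds to all rounds; later rounds do not matter. -/
def extendFaults {V : Type*} {T : ℕ} (ω : Fin T × V → Bool) (r : ℕ) (v : V) : Bool :=
  if h : r < T then ω (⟨r, h⟩, v) else false

/-- The probability that the schedule `S` has not delivered the messages `m` to all nodes after `T`
rounds, when every fault occurs independently with probability `p`. -/
def failProb {V : Type*} [Fintype V] {k : ℕ} {Msg Pkt : Type*} (G : SimpleGraph V) (s : V)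
    (fm : FaultModel) (p : unitInterval) (T : ℕ) (S : CodingSchedule V k Msg Pkt)
    (m : Fin k → Msg) : ℝ≥0∞ :=
  Measure.pi (fun _ : Fin T × V => bernoulliMeasure true false p)
    {ω | ¬ Solved G s fm S m T (extendFaults ω)}

/-! ### Messages and packets of `O(log (n k))` bits, coding throughput -/

/-- Bit strings of length `a * ⌈log₂ (n * k)⌉`. -/
abbrev Word (a n k : ℕ) : Type := Fin (a * Nat.clog 2 (n * k)) → Bool

/-- The least number of rounds of a coding schedule that broadcasts `k` messages of
`a * ⌈log₂ (n * k)⌉` bits with packets of `b * ⌈log₂ (n * k)⌉` bits and failure probability at most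
`1 / k` (`⊤` if there is none). -/
def minLength {V : Type*} [Fintype V] (G : SimpleGraph V) (s : V) (fm : FaultModel)
    (p : unitInterval) (a b k : ℕ) : ℝ≥0∞ :=
  ⨅ (T : ℕ) (_ : ∃ S : CodingSchedule V k (Word a (Fintype.card V) k) (Word b (Fintype.card V) k),
      ∀ m, failProb G s fm p T S m ≤ (k : ℝ≥0∞)⁻¹), (T : ℝ≥0∞)

/-- The coding throughput of the topology `(G, s)`. -/
def codingThroughput {V : Type*} [Fintype V] (G : SimpleGraph V) (s : V) (fm : FaultModel)
    (p : unitInterval) (a b : ℕ) : ℝ≥0∞ :=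
  limsup (fun k : ℕ => (k : ℝ≥0∞) / minLength G s fm p a b k) atTop

/-! ### Decay with random linear network coding -/

/-- An RLNC packet: a vector of `k` coefficients, and the linear combination of the messages (as
vectors of length `l` over `F`) with these coefficients. -/
abbrev RLNCPacket (F : Type*) (k l : ℕ) : Type _ := (Fin k → F) × (Fin l → F)

/-- The random choices of one node in one round: its Decay coin, and uniformly random coefficients
for its linear combination (the first family for the messages, used by the source; the second for
the packets received so far, used by the other nodes). -/
abbrev Coin (F : Type*) (k T : ℕ) : Type _ := Bool × (Fin k → F) × (Fin T → F)

/-- The Decay probability of round `r`. The rounds are interleaved modulo `3`, so round `r` is in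
slot `r / 3`. A phase has `⌈log₂ n⌉` slots, and the probability in its `i`-th slot
(`i = 1, 2, …`) is `2 ^ (-i)`. -/
def decayProb (n r : ℕ) : unitInterval :=
  ⟨(1 / 2 : ℝ) ^ (r / 3 % Nat.clog 2 n + 1), by positivity,
    pow_le_one₀ (by norm_num) (by norm_num)⟩

/-- The law of the random choices of one node in round `r`. -/
def coinLaw (F : Type*) [MeasurableSpace F] (n k T r : ℕ) : Measure (Coin F k T) :=
  (bernoulliMeasure true false (decayProb n r)).prod
    ((uniformOn Set.univ).prod (uniformOn Set.univ))

/-- The packet formed in a round: the combination of the pairs `(e i, m i)` with the first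
coefficients at the source, and of the packets heard so far with the second coefficients at every
other node (the zero packet if nothing was heard). -/
def rlncPacket {F : Type*} [Field F] {k l T : ℕ} (coin : Coin F k T)
    (known : Option (Fin k → Fin l → F)) (heard : List (Option (RLNCPacket F k l))) :
    RLNCPacket F k l :=
  match known with
  | some m => ∑ i, coin.2.1 i • ((Pi.single i 1, m i) : RLNCPacket F k l)
  | none => ∑ j : Fin T, coin.2.2 j • ((heard[(j : ℕ)]?).join).getD 0

open Classical in
/-- The coding schedule produced by Decay with random linear network coding from its random choices,
for `T` rounds. A node at distance `d` from the source takes part in the rounds `r ≡ d (mod 3)`; in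
these it broadcasts, if its Decay coin says so, a random linear combination of all it knows, whether
or not it has received anything yet. Decoding is by solving the linear system given by the received
packets. -/
def decayRLNC {V : Type*} (G : SimpleGraph V) (s : V) {F : Type*} [Field F] {k T : ℕ} (l : ℕ)
    (coins : Fin T × V → Coin F k T) : CodingSchedule V k (Fin l → F) (RLNCPacket F k l) where
  act u r known heard :=
    if h : r < T then
      if r % 3 = G.dist s u % 3 ∧ (coins (⟨r, h⟩, u)).1 = true then
        some (rlncPacket (coins (⟨r, h⟩, u)) known heard)
      else none
    else none
  decode _ heard :=
    Classical.epsilon fun m : Fin k → Fin l → F =>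
      ∀ y, some y ∈ heard → y.2 = ∑ i, y.1 i • m i

/-- The probability, over the faults and the random choices of the algorithm, that Decay with random
linear network coding over `F` has not delivered the messages `m` to all nodes after `T` rounds. -/
def decayRLNCFailProb {V : Type*} [Fintype V] (G : SimpleGraph V) (s : V) (fm : FaultModel)
    (p : unitInterval) {F : Type*} [Field F] [MeasurableSpace F] {k l : ℕ} (T : ℕ)
    (m : Fin k → Fin l → F) : ℝ≥0∞ :=
  Measure.pi (fun x : Fin T × V =>
      (bernoulliMeasure true false p).prod (coinLaw F (Fintype.card V) k T x.1))
    {ω | ¬ Solved G s fm (decayRLNC G s l fun x => (ω x).2) m T (extendFaults fun x => (ω x).1)}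

/-- `D log n + k log n + log² n` for a graph with `n` nodes and diameter `D`. -/
def roundBound {V : Type*} [Fintype V] (G : SimpleGraph V) (k : ℕ) : ℝ :=
  G.diam * Real.log (Fintype.card V) + k * Real.log (Fintype.card V)
    + Real.log (Fintype.card V) ^ 2

end NoisyRadio

end

/-! Fix a nonzero vector `μ` of coefficients and call a node informed if some packet it received has
a coefficient vector not orthogonal to `μ`. A fresh random combination formed by an informed node is
again not orthogonal to `μ` with probability at least `1/2`, so coding reduces, for each `μ`, to the
spreading of a single rumour. A node informed for every `μ ≠ 0` can decode, since the difference of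
two solutions of its linear system would be such a `μ`.

For one rumour, let `v` have `m` neighbours in the preceding layer. The interleaving modulo 3 leaves
only these to compete, and one slot of each Decay phase makes each of them the sole broadcaster with
probability at least `1/(8m)`. Broadcasting does not depend on what is known, so the present round
is independent of the informed set. Summing over the `m` disjoint events gives, with `ε = (1 -
p)/32`, `fail_{N+1}(x+1) ≤ (1-2ε) fail_N(x+1) + 2ε fail_N(x)`, which `2 ^ x * (1-ε) ^ N` solves
exactly (`Spreads.prob_step`, `Spreads.prob_block`). A union bound over all nodes and all `|F| ^ k`
vectors proves the first claim.

For short packets put `Λ = ⌈log₂ (n k)⌉`, split the messages into generations of `Λ` messages over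
the field with two elements, and pipeline these through blocks of `Λ` layers, a multiple of `Λ`
phases per block (`Spreads.prob_pipeline`). There are then only `2 ^ Λ` vectors per generation, and
the bad event has probability at most `2 ^ (-Λ)`. Since coefficients never depend on the messages
(`run_coefficients_eq`), one choice of coins that is no worse than average serves all messages and
yields a deterministic schedule. -/

noncomputable section

/-! ### Reception, histories and distance layers -/

namespace NoisyRadio

/-- The node whose fault spoils a transmission from `u` to `v`. -/
def FaultModel.culprit {V : Type*} : FaultModel → V → V → V
  | .sender, u, _ => u
  | .receiver, _, v => v

section Hearing

variable {V P Q : Type*} (G : SimpleGraph V) (fm : FaultModel) (fault : V → Bool)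

theorem hear_eq_of_unique {tx : V → Option P} {v u : V} (hv : tx v = none) (ha : G.Adj v u)
    (hu : tx u ≠ none) (huniq : ∀ w, G.Adj v w → tx w ≠ none → w = u) :
    hear G fm fault tx v = if fault (fm.culprit u v) then none else tx u := by
  have h : tx v = none ∧ ∃! u, G.Adj v u ∧ tx u ≠ none :=
    ⟨hv, u, ⟨ha, hu⟩, fun w hw => huniq w hw.1 hw.2⟩
  have hc : h.2.choose = u := huniq _ h.2.choose_spec.1.1 h.2.choose_spec.1.2
  unfold hear
  rw [dif_pos h]
  cases fm <;> dsimp only [FaultModel.culprit] <;> rw [hc] <;> congr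

theorem hear_cases (tx : V → Option P) (v : V) :
    (∃ u, tx v = none ∧ G.Adj v u ∧ tx u ≠ none ∧ ∀ w, G.Adj v w → tx w ≠ none → w = u) ∨
      (¬ (tx v = none ∧ ∃! u, G.Adj v u ∧ tx u ≠ none) ∧ hear G fm fault tx v = none) := by
  by_cases h : tx v = none ∧ ∃! u, G.Adj v u ∧ tx u ≠ none
  · obtain ⟨hv, u, hu, huniq⟩ := h
    exact .inl ⟨u, hv, hu.1, hu.2, fun w h1 h2 => huniq w ⟨h1, h2⟩⟩
  · exact .inr ⟨h, by unfold hear; rw [dif_neg h]⟩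

/-- Reception depends only on who is silent, never on packet contents. -/
theorem hear_map (tx : V → Option P) (κ : P → Q) (v : V) :
    hear G fm fault (fun u => (tx u).map κ) v = (hear G fm fault tx v).map κ := by
  rcases hear_cases G fm fault tx v with ⟨u, hv, ha, hu, huniq⟩ | ⟨hn, h⟩
  · rw [hear_eq_of_unique G fm fault hv ha hu huniq,
      hear_eq_of_unique G fm fault (by simp [hv]) ha (by simpa using hu)
        (fun w h1 h2 => huniq w h1 (by simpa using h2))]
    split_ifs <;> simp
  · rw [h]
    unfold hear
    rw [dif_neg (by simpa using hn)]
    rfl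

theorem exists_of_hear_eq_some {tx : V → Option P} {v : V} {y : P}
    (h : hear G fm fault tx v = some y) : ∃ u, tx u = some y := by
  rcases hear_cases G fm fault tx v with ⟨u, hv, ha, hu, huniq⟩ | ⟨-, hn⟩
  · rw [hear_eq_of_unique G fm fault hv ha hu huniq] at h
    split_ifs at h
    exact ⟨u, h⟩
  · simp [hn] at h

end Hearing

section History

variable {V : Type*} {k k' : ℕ} {Msg Msg' P P' Q : Type*} (G : SimpleGraph V) (s : V)
  (fm : FaultModel)

theorem history_congr (S S' : CodingSchedule V k Msg P) (m : Fin k → Msg)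
    (fault fault' : ℕ → V → Bool) {R : ℕ} (hS : ∀ r < R, ∀ u, S.act u r = S'.act u r)
    (hf : ∀ r < R, fault r = fault' r) :
    ∀ r ≤ R, history G s fm S m fault r = history G s fm S' m fault' r := by
  intro r
  induction r with
  | zero => intro _; rfl
  | succ r ih =>
    intro hr
    funext v
    simp only [history, ih (by omega), hS r (by omega), hf r (by omega)]

-- Compares runs with different messages through a projection of their packets; it will be applied
-- to the projection that keeps generation and coefficients.
open Classical in
theorem history_map_eq (S : CodingSchedule V k Msg P) (S' : CodingSchedule V k' Msg' P')
    (m : Fin k → Msg) (m' : Fin k' → Msg') (fault : ℕ → V → Bool) (κ : P → Q) (κ' : P' → Q)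
    (h : ∀ u r (l : List (Option P)) (l' : List (Option P')),
      l.map (Option.map κ) = l'.map (Option.map κ') →
      (S.act u r (if u = s then some m else none) l).map κ =
        (S'.act u r (if u = s then some m' else none) l').map κ') :
    ∀ r v, (history G s fm S m fault r v).map (Option.map κ) =
      (history G s fm S' m' fault r v).map (Option.map κ') := by
  intro r
  induction r with
  | zero => intro v; rfl
  | succ r ih =>
    intro v
    simp only [history, List.map_cons, ih, List.cons.injEq, and_true]
    rw [← hear_map, ← hear_map]
    congr 1
    funext u
    exact h u r _ _ (ih u)

open Classical in
theorem forall_mem_history (S : CodingSchedule V k Msg P) (m : Fin k → Msg)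
    (fault : ℕ → V → Bool) (p : P → Prop)
    (h : ∀ u r l, (∀ y, some y ∈ l → p y) →
      ∀ y, S.act u r (if u = s then some m else none) l = some y → p y) :
    ∀ r v y, some y ∈ history G s fm S m fault r v → p y := by
  intro r
  induction r with
  | zero => intro v y hy; simp [history] at hy
  | succ r ih =>
    intro v y hy
    simp only [history, List.mem_cons] at hy
    rcases hy with hy | hy
    · obtain ⟨u, hu⟩ := exists_of_hear_eq_some G fm _ hy.symm
      exact h u r _ (ih u) y hu
    · exact ih v y hy

theorem mem_history_succ {S : CodingSchedule V k Msg P} {m : Fin k → Msg}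
    {fault : ℕ → V → Bool} {r : ℕ} {v : V} {y : Option P}
    (h : y ∈ history G s fm S m fault r v) : y ∈ history G s fm S m fault (r + 1) v :=
  List.mem_cons_of_mem _ h

theorem length_history (S : CodingSchedule V k Msg P) (m : Fin k → Msg) (fault : ℕ → V → Bool)
    (r : ℕ) (v : V) : (history G s fm S m fault r v).length = r := by
  induction r with
  | zero => rfl
  | succ r ih => simp [history, ih]

end History

/-- A schedule in which the nodes broadcast in the rounds that Decay prescribes, whatever the rule
`A` by which the packets are formed from the coins. -/
def decaySchedule {V : Type*} (G : SimpleGraph V) (s : V) {F Msg P : Type*} {k g T : ℕ}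
    (A : V → ℕ → Coin F g T → Option (Fin k → Msg) → List (Option P) → P)
    (dec : V → List (Option P) → Fin k → Msg) (coins : Fin T × V → Coin F g T) :
    CodingSchedule V k Msg P where
  act u r known heard :=
    open Classical in
    if h : r < T then
      if r % 3 = G.dist s u % 3 ∧ (coins (⟨r, h⟩, u)).1 = true then
        some (A u r (coins (⟨r, h⟩, u)) known heard)
      else none
    else none
  decode := dec

theorem dist_le_dist_add_one {V : Type*} {G : SimpleGraph V} (hG : G.Connected) (s : V) {v w : V}
    (h : G.Adj v w) : G.dist s w ≤ G.dist s v + 1 := by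
  have h1 := hG.dist_triangle (u := s) (v := v) (w := w)
  rwa [SimpleGraph.dist_eq_one_iff_adj.2 h] at h1

theorem exists_adj_dist_eq {V : Type*} {G : SimpleGraph V} (hG : G.Connected) (s : V) {v : V}
    {d : ℕ} (h : G.dist s v = d + 1) : ∃ u, G.Adj v u ∧ G.dist s u = d := by
  obtain ⟨p, hp⟩ := hG.exists_walk_length_eq_dist v s
  rw [SimpleGraph.dist_comm, h] at hp
  cases p with
  | nil => simp at hp
  | @cons _ u _ huv q =>
    refine ⟨u, huv, ?_⟩
    have h1 := SimpleGraph.dist_le q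
    have h2 := dist_le_dist_add_one hG s huv.symm
    rw [SimpleGraph.dist_comm] at h1
    simp only [SimpleGraph.Walk.length_cons] at hp
    omega

theorem dist_lt_card {V : Type*} [Fintype V] {G : SimpleGraph V} (hG : G.Connected) (s v : V) :
    G.dist s v < Fintype.card V := by
  obtain ⟨p, hp, hl⟩ := hG.exists_path_of_dist s v
  exact hl ▸ hp.length_lt

theorem dist_le_diam {V : Type*} [Finite V] {G : SimpleGraph V} (hG : G.Connected) (s v : V) :
    G.dist s v ≤ G.diam :=
  haveI := hG.nonempty
  SimpleGraph.dist_le_diam (SimpleGraph.connected_iff_ediam_ne_top.1 hG)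

end NoisyRadio

end

/-! ### Independence of one round from the past, and uniform coefficients -/

noncomputable section

namespace NoisyRadio

/-- In a finite product space, let `A` and the box `S` only depend on the coordinates outside `s`.
Then conditioning on `A` does not change the probability of hitting the box. -/
theorem mul_pi_le_pi_box {ι : Type*} [Fintype ι] {Ω : ι → Type*} [∀ i, MeasurableSpace (Ω i)]
    [∀ i, Finite (Ω i)] [∀ i, MeasurableSingletonClass (Ω i)] (μ : ∀ i, Measure (Ω i))
    [∀ i, IsProbabilityMeasure (μ i)] (s : Set ι) (A : Set (∀ i, Ω i))
    (S : (∀ i, Ω i) → ∀ i, Set (Ω i)) (c : ℝ≥0∞)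
    (hA : ∀ ω ω', (∀ i ∉ s, ω i = ω' i) → ω ∈ A → ω' ∈ A)
    (hS : ∀ ω ω', (∀ i ∉ s, ω i = ω' i) → S ω = S ω')
    (hs : ∀ ω, ∀ i ∉ s, S ω i = Set.univ) (hc : ∀ ω ∈ A, c ≤ ∏ i, μ i (S ω i)) :
    c * Measure.pi μ A ≤ Measure.pi μ {ω ∈ A | ∀ i, ω i ∈ S ω i} := by
  classical
  rcases Set.eq_empty_or_nonempty A with rfl | ⟨ω₀, hω₀⟩
  · simp
  -- Fubini: once the coordinates `y` outside `s` are fixed, both `A` and the box are determined,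
  -- and the box has its product measure.
  set e := MeasurableEquiv.piEquivPiSubtypeProd Ω (· ∈ s)
  have hP : MeasurePreserving e.symm _ _ :=
    (measurePreserving_piEquivPiSubtypeProd μ (· ∈ s)).symm e
  have hagree : ∀ x x' y, ∀ i ∉ s, e.symm (x, y) i = e.symm (x', y) i := by
    intro x x' y i hi
    simp [e, MeasurableEquiv.piEquivPiSubtypeProd, Equiv.piEquivPiSubtypeProd, hi]
  rw [← hP.measure_preimage_equiv, ← hP.measure_preimage_equiv,
    Measure.prod_apply_symm (Set.toFinite _).measurableSet,
    Measure.prod_apply_symm (Set.toFinite _).measurableSet,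
    ← lintegral_const_mul' _ _ ?_]
  swap
  · refine ne_top_of_le_ne_top ENNReal.one_ne_top ((hc ω₀ hω₀).trans ?_)
    exact Finset.prod_le_one' fun i _ => prob_le_one
  refine lintegral_mono fun y => ?_
  by_cases hy : ∃ x, e.symm (x, y) ∈ A
  · obtain ⟨x, hx⟩ := hy
    calc _ ≤ c * 1 := by gcongr; exact prob_le_one
      _ ≤ ∏ i, μ i (S (e.symm (x, y)) i) := by rw [mul_one]; exact hc _ hx
      _ = ∏ i : {i // i ∈ s}, μ i (S (e.symm (x, y)) i) := by
        rw [← Fintype.prod_subtype_mul_prod_subtype (· ∈ s)]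
        conv_rhs => rw [← mul_one (∏ i : {i // i ∈ s}, μ i (S (e.symm (x, y)) i))]
        congr 1
        exact Finset.prod_eq_one fun i _ => by rw [hs _ _ i.2, measure_univ]
      _ = Measure.pi (fun i : {i // i ∈ s} => μ i)
            (Set.univ.pi fun i : {i // i ∈ s} => S (e.symm (x, y)) i) := (Measure.pi_pi _ _).symm
      _ ≤ _ := by
        refine measure_mono fun x' hx' => ?_
        have h1 := hagree x x' y
        refine ⟨hA _ _ h1 hx, fun i => ?_⟩
        by_cases hi : i ∈ s
        · have h2 := hx' ⟨i, hi⟩ trivial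
          rw [hS _ _ h1] at h2
          convert h2
          simp [e, MeasurableEquiv.piEquivPiSubtypeProd, Equiv.piEquivPiSubtypeProd, hi]
        · rw [hs _ i hi]; trivial
  · have : (fun x => (x, y)) ⁻¹' (e.symm ⁻¹' A) = ∅ := by
      ext x; simpa using fun h => hy ⟨x, h⟩
    rw [this]; simp

section Uniform

variable {F : Type*} [Field F] [Fintype F] [MeasurableSpace F] [MeasurableSingletonClass F]

/-- A nonzero linear functional does not vanish on uniformly random coefficients with probability at
least one half. -/
theorem half_le_uniformOn_ne_zero {g T : ℕ} (a : Fin g → F) (b : Fin T → F)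
    (h : a ≠ 0 ∨ b ≠ 0) :
    (2 : ℝ≥0∞)⁻¹ ≤ ((uniformOn Set.univ : Measure (Fin g → F)).prod
      (uniformOn Set.univ : Measure (Fin T → F)))
      {z | ∑ i, z.1 i * a i + ∑ j, z.2 j * b j ≠ 0} := by
  classical
  set ρ := (uniformOn Set.univ : Measure (Fin g → F)).prod
      (uniformOn Set.univ : Measure (Fin T → F))
  have : IsProbabilityMeasure (uniformOn Set.univ : Measure (Fin g → F)) :=
    isProbabilityMeasure_uniformOn Set.finite_univ Set.univ_nonempty
  have : IsProbabilityMeasure (uniformOn Set.univ : Measure (Fin T → F)) :=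
    isProbabilityMeasure_uniformOn Set.finite_univ Set.univ_nonempty
  have hsing : ∀ z z', ρ {z} = ρ {z'} := by
    intro z z'
    simp only [ρ, 
      show ∀ z : (Fin g → F) × (Fin T → F), {z} = ({z.1} : Set _) ×ˢ ({z.2} : Set _) from
        fun z => by simp, Measure.prod_prod, uniformOn_univ, Measure.count_singleton]
  -- Translation by a `w` outside the kernel preserves the uniform measure and carries the kernel
  -- into its complement.
  obtain ⟨w, hw⟩ : ∃ w : (Fin g → F) × (Fin T → F),
      ∑ i, w.1 i * a i + ∑ j, w.2 j * b j ≠ 0 := by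
    rcases h with h | h
    · obtain ⟨i, hi⟩ := Function.ne_iff.1 h
      exact ⟨(Pi.single i 1, 0), by simpa [Pi.single_apply] using hi⟩
    · obtain ⟨i, hi⟩ := Function.ne_iff.1 h
      exact ⟨(0, Pi.single i 1), by simpa [Pi.single_apply] using hi⟩
  set B := {z : (Fin g → F) × (Fin T → F) | ∑ i, z.1 i * a i + ∑ j, z.2 j * b j ≠ 0}
  have hinv : ρ.map (w + ·) = ρ := by
    refine Measure.ext_of_singleton fun z => ?_
    rw [Measure.map_apply (measurable_of_countable _) (measurableSet_singleton _)]
    rw [show (fun x => w + x) ⁻¹' {z} = {z - w} by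
      ext x; simp only [Set.mem_preimage, Set.mem_singleton_iff]; rw [eq_sub_iff_add_eq, add_comm]]
    exact hsing _ _
  have h1 : ρ Bᶜ ≤ ρ B := by
    calc ρ Bᶜ ≤ ρ ((w + ·) ⁻¹' B) := by
          refine measure_mono fun x hx => ?_
          have hx : ∑ i, x.1 i * a i + ∑ j, x.2 j * b j = 0 := by simpa [B] using hx
          have : ∑ i, (w + x).1 i * a i + ∑ j, (w + x).2 j * b j =
              (∑ i, w.1 i * a i + ∑ j, w.2 j * b j) +
                (∑ i, x.1 i * a i + ∑ j, x.2 j * b j) := by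
            simp only [Prod.fst_add, Prod.snd_add, Pi.add_apply, add_mul, Finset.sum_add_distrib]
            ring
          change ∑ i, (w + x).1 i * a i + ∑ j, (w + x).2 j * b j ≠ 0
          rwa [this, hx, add_zero]
      _ = ρ B := by
          rw [← Measure.map_apply (measurable_of_countable _) (Set.toFinite _).measurableSet, hinv]
  have h2 : ρ B + ρ Bᶜ = 1 := by
    rw [measure_add_measure_compl (Set.toFinite _).measurableSet, measure_univ]
  rw [ENNReal.inv_le_iff_le_mul (by simp) (by simp), ← h2, two_mul]
  gcongr

end Uniform

end NoisyRadio

end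

/-! ### One round of Decay -/

noncomputable section

namespace NoisyRadio

/-- If each of `m` nodes broadcasts with probability `2 ^ (-i)`, where `2 ^ (i - 1) ≤ m < 2 ^ i`, then
exactly one of them does so with probability at least `1 / 8`. -/
theorem one_eighth_le_mul_pow {m : ℕ} (hm : 1 ≤ m) :
    1 / 8 ≤ (m : ℝ) * ((1 / 2) ^ (Nat.log 2 m + 1) * (1 - (1 / 2) ^ (Nat.log 2 m + 1)) ^ (m - 1)) := by
  set h : ℕ := 2 ^ Nat.log 2 m with hh
  have h1 : h ≤ m := Nat.pow_log_le_self 2 (by omega)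
  have h2 : m < 2 * h := by
    have := Nat.lt_pow_succ_log_self (b := 2) (by norm_num) m
    rw [pow_succ] at this; omega
  have hpos : (0 : ℝ) < h := by positivity
  have hq : ((1 : ℝ) / 2) ^ (Nat.log 2 m + 1) = 1 / (2 * h) := by
    rw [hh]; push_cast; rw [one_div_pow, pow_succ]; ring_nf
  have hone : (1 : ℝ) ≤ h := by
    have : 1 ≤ h := Nat.one_le_two_pow
    exact_mod_cast this
  rw [hq]
  have hq1 : (1 : ℝ) / (2 * h) ≤ 1 / 2 := by
    rw [div_le_div_iff₀ (by positivity) (by norm_num)]; linarith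
  -- Bernoulli's inequality; squaring it covers the exponent `m - 1 ≤ 2 * h`.
  have h3 : (1 : ℝ) / 2 ≤ (1 - 1 / (2 * h)) ^ h := by
    have := one_add_mul_le_pow (a := -(1 / (2 * (h : ℝ)))) (by linarith) h
    rw [← sub_eq_add_neg] at this
    refine le_trans (le_of_eq ?_) this
    field_simp; ring
  have h4 : (1 : ℝ) / 4 ≤ (1 - 1 / (2 * h)) ^ (m - 1) := by
    calc (1 : ℝ) / 4 ≤ ((1 - 1 / (2 * (h : ℝ))) ^ h) ^ 2 := by nlinarith
      _ = (1 - 1 / (2 * (h : ℝ))) ^ (h * 2) := (pow_mul _ _ _).symm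
      _ ≤ _ := pow_le_pow_of_le_one (by linarith) (by
          have : (0 : ℝ) ≤ 1 / (2 * h) := by positivity
          linarith) (by omega)
  have h5 : (1 : ℝ) / 2 ≤ m * (1 / (2 * h)) := by
    rw [mul_one_div, div_le_div_iff₀ (by norm_num) (by positivity)]
    have : (h : ℝ) ≤ m := by exact_mod_cast h1
    linarith
  rw [← mul_assoc]
  nlinarith

/-- The outcomes of all faults and all random choices in `T` rounds. -/
abbrev Outcome (V F : Type*) (g T : ℕ) : Type _ := Fin T × V → Bool × Coin F g T

instance coinLaw.isProbabilityMeasure (F : Type*) [Field F] [Fintype F] [MeasurableSpace F]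
    [MeasurableSingletonClass F] (n g T r : ℕ) : IsProbabilityMeasure (coinLaw F n g T r) := by
  have : IsProbabilityMeasure (uniformOn Set.univ : Measure (Fin g → F)) :=
    isProbabilityMeasure_uniformOn Set.finite_univ Set.univ_nonempty
  have : IsProbabilityMeasure (uniformOn Set.univ : Measure (Fin T → F)) :=
    isProbabilityMeasure_uniformOn Set.finite_univ Set.univ_nonempty
  unfold coinLaw
  infer_instance

/-- The law of the faults and of the random choices of Decay. -/
def outcomeLaw (V : Type*) [Fintype V] (p : unitInterval) (F : Type*) [MeasurableSpace F]
    (g T : ℕ) : Measure (Outcome V F g T) :=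
  Measure.pi fun x => (bernoulliMeasure true false p).prod (coinLaw F (Fintype.card V) g T x.1)

section Box

variable {V F : Type*} [Fintype V] {g T : ℕ}

/-- The outcomes of a round, node by node, in which `u` is the only node of `N` that broadcasts, the
coefficients that `u` chooses are in `X`, and no fault spoils the transmission from `u` to `v`. -/
def transmissionBox (fm : FaultModel) (N : Finset V) (u v : V)
    (X : Set ((Fin g → F) × (Fin T → F))) (w : V) : Set (Bool × Coin F g T) :=
  {b | w = fm.culprit u v → b = false} ×ˢ
    ({b | (w = u → b = true) ∧ (w ∈ N → w ≠ u → b = false)} ×ˢ {z | w = u → z ∈ X})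

/-- The product factors into no fault at the culprit (`1 - p`), `u` being the sole broadcaster of
`N` (at least `1/8` divided by the size of `N`), and good coefficients (at least `1/2`). -/
theorem le_prod_transmissionBox [Field F] [Fintype F] [MeasurableSpace F]
    [MeasurableSingletonClass F] (p : unitInterval) (fm : FaultModel) {N : Finset V} {u : V}
    (hu : u ∈ N) (v : V) {X : Set ((Fin g → F) × (Fin T → F))} {n r : ℕ}
    (hX : (2 : ℝ≥0∞)⁻¹ ≤ ((uniformOn Set.univ : Measure (Fin g → F)).prod
      (uniformOn Set.univ : Measure (Fin T → F))) X)
    (hr : r / 3 % Nat.clog 2 n = Nat.log 2 N.card) :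
    ENNReal.ofReal ((1 - p) / 16 / N.card) ≤
      ∏ w, ((bernoulliMeasure true false p).prod (coinLaw F n g T r))
        (transmissionBox fm N u v X w) := by
  classical
  have : IsProbabilityMeasure (uniformOn Set.univ : Measure (Fin g → F)) :=
    isProbabilityMeasure_uniformOn Set.finite_univ Set.univ_nonempty
  have : IsProbabilityMeasure (uniformOn Set.univ : Measure (Fin T → F)) :=
    isProbabilityMeasure_uniformOn Set.finite_univ Set.univ_nonempty
  set q : ℝ := (1 / 2) ^ (Nat.log 2 N.card + 1)
  have hq : (decayProb n r : ℝ) = q := by simp [decayProb, hr, q]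
  have hm : 1 ≤ N.card := Finset.card_pos.2 ⟨u, hu⟩
  have hq0 : 0 ≤ q := by positivity
  have hq1 : q ≤ 1 := pow_le_one₀ (by norm_num) (by norm_num)
  have hp0 : 0 ≤ 1 - (p : ℝ) := sub_nonneg.2 p.2.2
  have hbern : ∀ (p : unitInterval) (b : Bool), bernoulliMeasure true false p {b} =
      ENNReal.ofReal (if b then p else 1 - p) := by
    intro p b
    rw [← ENNReal.ofReal_toReal (measure_ne_top _ _), ← measureReal_def,
      bernoulliMeasure_real_apply _ (measurableSet_singleton _)]
    cases b <;> simp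
  have e1 : ∀ w, bernoulliMeasure true false p {b | w = fm.culprit u v → b = false} =
      if w = fm.culprit u v then ENNReal.ofReal (1 - p) else 1 := by
    intro w
    split_ifs with h
    · simpa [h] using hbern p false
    · simp [h]
  have e2 : ∀ w, bernoulliMeasure true false (decayProb n r)
        {b | (w = u → b = true) ∧ (w ∈ N → w ≠ u → b = false)} =
      if w ∈ N then (if w = u then ENNReal.ofReal q else ENNReal.ofReal (1 - q)) else 1 := by
    intro w
    split_ifs with h h'
    · simpa [h', hq] using hbern (decayProb n r) true
    · simpa [h, h', hq] using hbern (decayProb n r) false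
    · have : w ≠ u := fun h' => h (h' ▸ hu)
      simp [h, this]
  have e3 : ∀ w, ((uniformOn Set.univ : Measure (Fin g → F)).prod
      (uniformOn Set.univ : Measure (Fin T → F))) {z | w = u → z ∈ X} =
      if w = u then ((uniformOn Set.univ : Measure (Fin g → F)).prod
      (uniformOn Set.univ : Measure (Fin T → F))) X else 1 := by
    intro w
    split_ifs with h
    · simp [h]
    · simp [h]
  simp only [transmissionBox, coinLaw, Measure.prod_prod, e1, e2, e3, Finset.prod_mul_distrib]
  rw [Finset.prod_ite_eq' , Finset.prod_ite_eq', Finset.prod_ite_mem, Finset.univ_inter,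
    ← Finset.mul_prod_erase _ _ hu, if_pos rfl, if_pos (Finset.mem_univ _),
    if_pos (Finset.mem_univ _),
    Finset.prod_congr rfl (g := fun _ => ENNReal.ofReal (1 - q))
      (fun x hx => by simp [Finset.ne_of_mem_erase hx]),
    Finset.prod_const, Finset.card_erase_of_mem hu]
  calc _ ≤ ENNReal.ofReal ((1 - p) * (q * (1 - q) ^ (N.card - 1) * 2⁻¹)) := by
        refine ENNReal.ofReal_le_ofReal ?_
        have := one_eighth_le_mul_pow hm
        have hm' : (0 : ℝ) < N.card := by exact_mod_cast hm
        rw [div_div, div_eq_mul_inv]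
        refine mul_le_mul_of_nonneg_left ?_ hp0
        rw [inv_le_iff_one_le_mul₀ (by positivity)]
        linarith
    _ ≤ _ := by
        rw [ENNReal.ofReal_mul hp0, ENNReal.ofReal_mul (by
            have := pow_nonneg (sub_nonneg.2 hq1) (N.card - 1); positivity),
          ENNReal.ofReal_mul hq0, ENNReal.ofReal_pow (sub_nonneg.2 hq1),
          ENNReal.ofReal_inv_of_pos (by norm_num)]
        gcongr
        simpa using hX

end Box

end NoisyRadio

end

/-! ### Spreading of one rumour through the layers -/

noncomputable section

set_option linter.unusedSectionVars false

namespace NoisyRadio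

/-- Two outcomes agree in all rounds before round `r`. -/
def AgreeBefore {V F : Type*} {g T : ℕ} (r : ℕ) (ω ω' : Outcome V F g T) : Prop :=
  ∀ x : Fin T × V, (x.1 : ℕ) < r → ω x = ω' x

/-- `K r v` is the event that node `v` is informed before round `r`. Informed nodes in layer `d`
inform, in the rounds with `ok d r`, the next layer whenever they are heard there and their
coefficients are good. -/
structure Spreads {V F : Type*} [Field F] [MeasurableSpace F] {g T : ℕ} (G : SimpleGraph V) (s : V)
    (fm : FaultModel) (ok : ℕ → ℕ → Prop) (K : ℕ → V → Set (Outcome V F g T))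
    (good : ℕ → V → Outcome V F g T → Set ((Fin g → F) × (Fin T → F))) : Prop where
  source : ∀ r, K r s = Set.univ
  mono : ∀ r v, K r v ⊆ K (r + 1) v
  past : ∀ r v ω ω', AgreeBefore r ω ω' → ω ∈ K r v → ω' ∈ K r v
  good_past : ∀ r u ω ω', AgreeBefore r ω ω' → good r u ω = good r u ω'
  half_le_good : ∀ (r : Fin T) u ω, ω ∈ K r u → (2 : ℝ≥0∞)⁻¹ ≤
    ((uniformOn Set.univ : Measure (Fin g → F)).prod (uniformOn Set.univ : Measure (Fin T → F)))
      (good r u ω)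
  inform : ∀ (r : Fin T) u v ω, ok (G.dist s u) r → G.Adj v u → G.dist s v = G.dist s u + 1 →
    r % 3 = G.dist s u % 3 → (ω (r, u)).2.1 = true →
    (∀ w, G.Adj v w → G.dist s w = G.dist s u → w ≠ u → (ω (r, w)).2.1 = false) →
    (ω (r, fm.culprit u v)).1 = false → ω ∈ K r u → (ω (r, u)).2.2 ∈ good r u ω → ω ∈ K (r + 1) v

namespace Spreads

variable {V F : Type*} [Fintype V] [Field F] [Fintype F] [MeasurableSpace F]
  [MeasurableSingletonClass F] {g T : ℕ} {G : SimpleGraph V} {s : V} {fm : FaultModel}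
  {ok : ℕ → ℕ → Prop} {K : ℕ → V → Set (Outcome V F g T)}
  {good : ℕ → V → Outcome V F g T → Set ((Fin g → F) × (Fin T → F))} {p : unitInterval}

instance isProbabilityMeasure : IsProbabilityMeasure (outcomeLaw V p F g T) := by unfold outcomeLaw; infer_instance

theorem measurableSet (A : Set (Outcome V F g T)) : MeasurableSet A := (Set.toFinite A).measurableSet

theorem mono_le (h : Spreads G s fm ok K good) {r r' : ℕ} (hr : r ≤ r') (v : V) :
    K r v ⊆ K r' v := by
  induction hr with
  | refl => exact subset_rfl
  | step _ ih => exact ih.trans (h.mono _ _)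

theorem prob_antitone (h : Spreads G s fm ok K good) {r r' : ℕ} (hr : r ≤ r') (v : V) :
    (outcomeLaw V p F g T).real (K r' v)ᶜ ≤ (outcomeLaw V p F g T).real (K r v)ᶜ :=
  measureReal_mono (Set.compl_subset_compl.2 (h.mono_le hr v))

theorem prob_source (h : Spreads G s fm ok K good) (r : ℕ) :
    (outcomeLaw V p F g T).real (K r s)ᶜ = 0 := by
  simp [h.source]

/-- Who is informed and which coefficients are good is settled before round `r`, whereas the box
constrains round `r` alone, so `mul_pi_le_pi_box` applies. -/
theorem mul_prob_le_transmission (h : Spreads G s fm ok K good) (r : Fin T) {N : Finset V} {u v : V}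
    (hu : u ∈ N) (hr : r / 3 % Nat.clog 2 (Fintype.card V) = Nat.log 2 N.card) :
    (1 - (p : ℝ)) / 16 / N.card * (outcomeLaw V p F g T).real (K r u \ K r v) ≤
      (outcomeLaw V p F g T).real {ω ∈ K r u \ K r v |
        ∀ w, ω (r, w) ∈ transmissionBox fm N u v (good r u ω) w} := by
  classical
  have hp0 : 0 ≤ 1 - (p : ℝ) := sub_nonneg.2 p.2.2
  have agree : ∀ ω ω' : Outcome V F g T, (∀ i ∉ {x : Fin T × V | x.1 = r}, ω i = ω' i) →
      AgreeBefore r ω ω' := by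
    intro ω ω' hag x hx
    exact hag x fun hx' => by
      simp only [Set.mem_ofPred_eq] at hx'
      rw [hx'] at hx; exact lt_irrefl _ hx
  have key := mul_pi_le_pi_box
    (fun x : Fin T × V => (bernoulliMeasure true false p).prod
      (coinLaw F (Fintype.card V) g T x.1))
    {x | x.1 = r} (K r u \ K r v)
    (fun ω x => if x.1 = r then transmissionBox fm N u v (good r u ω) x.2 else Set.univ)
    (ENNReal.ofReal ((1 - p) / 16 / N.card)) ?_ ?_ ?_ ?_
  · have h1 := ENNReal.toReal_mono (measure_ne_top _ _) key
    rw [ENNReal.toReal_mul, ENNReal.toReal_ofReal (by positivity)] at h1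
    refine h1.trans (le_of_eq ?_)
    change (outcomeLaw V p F g T).real _ = _
    congr 1
    ext ω
    simp only [Set.mem_ofPred_eq, and_congr_right_iff]
    intro _
    constructor
    · intro hb w
      simpa using hb (r, w)
    · rintro hb ⟨r', w⟩
      split_ifs with hx
      · obtain rfl : r' = r := hx
        exact hb w
      · trivial
  · intro ω ω' hag hω
    exact ⟨h.past _ _ _ _ (agree _ _ hag) hω.1,
      fun hv => hω.2 (h.past _ _ _ _ (agree _ _ fun i hi => (hag i hi).symm) hv)⟩
  · intro ω ω' hag
    rw [h.good_past _ _ _ _ (agree _ _ hag)]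
  · intro ω i hi
    exact if_neg hi
  · intro ω hω
    rw [Fintype.prod_prod_type, Finset.prod_eq_single r]
    · simp only [if_true]
      exact le_prod_transmissionBox p fm hu v (h.half_le_good _ _ _ hω.1) hr
    · intro r' _ hr'
      simp [hr']
    · simp

/-- The events that `u` alone of `N` informs `v` are disjoint, and each has probability at least
`(1-p)/16` divided by the size of `N`, times `P(u informed, v not)`. Their sum cancels that size.
Only marginal failure probabilities enter, so the neighbours may be correlated. -/
theorem prob_step (h : Spreads G s fm ok K good) (r : Fin T) {v : V} {d : ℕ}
    (hd : G.dist s v = d + 1) (hok : ok d r) (hrd : r % 3 = d % 3) {N : Finset V}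
    (hN : ∀ w, w ∈ N ↔ G.Adj v w ∧ G.dist s w = d) (hN0 : N.Nonempty)
    (hr : r / 3 % Nat.clog 2 (Fintype.card V) = Nat.log 2 N.card) {Y : ℝ}
    (hY : ∀ u ∈ N, (outcomeLaw V p F g T).real (K r u)ᶜ ≤ Y) :
    (outcomeLaw V p F g T).real (K (r + 1) v)ᶜ ≤
      (1 - (1 - p) / 16) * (outcomeLaw V p F g T).real (K r v)ᶜ + (1 - p) / 16 * Y := by
  classical
  set P := (outcomeLaw V p F g T)
  have hp0 : 0 ≤ 1 - (p : ℝ) := sub_nonneg.2 p.2.2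
  have hm : (0 : ℝ) < N.card := by exact_mod_cast hN0.card_pos
  set E : V → Set (Outcome V F g T) := fun u => {ω ∈ K r u \ K r v |
        ∀ w, ω (r, w) ∈ transmissionBox fm N u v (good r u ω) w}
  have hE1 : ∀ u ∈ N, E u ⊆ (K r v)ᶜ ∩ K (r + 1) v := by
    intro u hu ω hω
    obtain ⟨⟨hku, hkv⟩, hb⟩ := hω
    have hu' := (hN u).1 hu
    refine ⟨hkv, h.inform r u v ω (by rwa [hu'.2]) hu'.1 (by rw [hd, hu'.2]) (by rw [hrd, hu'.2])
      ((hb u).2.1.1 rfl) ?_ ((hb _).1 rfl) hku ((hb u).2.2 rfl)⟩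
    intro w hw1 hw2 hw3
    exact (hb w).2.1.2 ((hN w).2 ⟨hw1, hw2.trans hu'.2⟩) hw3
  have hE2 : Set.PairwiseDisjoint (N : Set V) E := by
    intro u hu u' hu' hne
    refine Set.disjoint_left.2 fun ω hω hω' => ?_
    have h1 := (hω.2 u).2.1.1 rfl
    have h2 := (hω'.2 u).2.1.2 hu hne
    rw [h1] at h2
    exact absurd h2 (by simp)
  have h1 : ∑ u ∈ N, P.real (E u) ≤ P.real (K r v)ᶜ - P.real (K (r + 1) v)ᶜ := by
    rw [← measureReal_biUnion_finset hE2 (fun _ _ => measurableSet _), le_sub_iff_add_le,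
      ← measureReal_union _ (measurableSet _) (measure_ne_top _ _) (measure_ne_top _ _)]
    · refine measureReal_mono (Set.union_subset (Set.iUnion₂_subset fun u hu => ?_) ?_)
      · exact (hE1 u hu).trans Set.inter_subset_left
      · exact Set.compl_subset_compl.2 (h.mono _ _)
    · rw [Set.disjoint_compl_right_iff_subset]
      exact Set.iUnion₂_subset fun u hu => (hE1 u hu).trans Set.inter_subset_right
  have h2 : ∀ u ∈ N, (1 - (p : ℝ)) / 16 / N.card * (P.real (K r v)ᶜ - Y) ≤ P.real (E u) := by
    intro u hu
    refine le_trans ?_ (h.mul_prob_le_transmission r hu hr)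
    refine mul_le_mul_of_nonneg_left ?_ (by positivity)
    have : P.real (K r v)ᶜ ≤ P.real (K r u \ K r v) + P.real (K r u)ᶜ := by
      refine le_trans (measureReal_mono ?_) (measureReal_union_le _ _)
      intro ω hω
      by_cases hu : ω ∈ K r u
      · exact .inl ⟨hu, hω⟩
      · exact .inr hu
    linarith [hY u hu]
  have h3 := Finset.sum_le_sum h2
  rw [Finset.sum_const, nsmul_eq_mul] at h3
  have h4 : (N.card : ℝ) * ((1 - (p : ℝ)) / 16 / N.card * (P.real (K r v)ᶜ - Y)) =
      (1 - p) / 16 * (P.real (K r v)ᶜ - Y) := by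
    field_simp
  rw [h4] at h3
  linarith

/-- In the block that consists of `B` phases after the first `q` phases, the information spreads
from layer `d₀` to the next `H` layers. -/
theorem prob_block (h : Spreads G s fm ok K good) (hG : G.Connected) {q B d₀ H : ℕ} {Y : ℝ}
    (hT : 3 * Nat.clog 2 (Fintype.card V) * (q + B) ≤ T)
    (hok : ∀ d r, d₀ ≤ d → d < d₀ + H → 3 * Nat.clog 2 (Fintype.card V) * q ≤ r →
      r < 3 * Nat.clog 2 (Fintype.card V) * (q + B) → ok d r)
    (hY : ∀ u, G.dist s u = d₀ →
      (outcomeLaw V p F g T).real (K (3 * Nat.clog 2 (Fintype.card V) * q) u)ᶜ ≤ Y) (hY0 : 0 ≤ Y) :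
    ∀ N ≤ B, ∀ x ≤ H, ∀ v, G.dist s v = d₀ + x →
      (outcomeLaw V p F g T).real (K (3 * Nat.clog 2 (Fintype.card V) * (q + N)) v)ᶜ ≤
        Y + 2 ^ x * (1 - (1 - p) / 32) ^ N := by
  classical
  set L := Nat.clog 2 (Fintype.card V)
  set P := (outcomeLaw V p F g T)
  have hp0 : 0 ≤ 1 - (p : ℝ) := sub_nonneg.2 p.2.2
  have hp1 : 1 - (p : ℝ) ≤ 1 := by linarith [p.2.1]
  intro N
  induction N with
  | zero =>
    intro _ x _ v _
    have h1 : P.real (K (3 * L * (q + 0)) v)ᶜ ≤ 1 := measureReal_le_one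
    have h2 : (1 : ℝ) ≤ 2 ^ x := one_le_pow₀ (by norm_num)
    rw [pow_zero, mul_one]
    linarith
  | succ N ih =>
    intro hN x hx v hv
    rcases x with _ | x
    · have h1 : P.real (K (3 * L * (q + (N + 1))) v)ᶜ ≤ P.real (K (3 * L * q) v)ᶜ :=
        h.prob_antitone (Nat.mul_le_mul_left _ (by omega)) v
      have h2 : 0 ≤ (2 : ℝ) ^ 0 * (1 - (1 - p) / 32) ^ (N + 1) :=
        mul_nonneg (by positivity) (pow_nonneg (by linarith) _)
      linarith [hY v hv]
    · set M : Finset V := {w | G.Adj v w ∧ G.dist s w = d₀ + x}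
      have hM : ∀ w, w ∈ M ↔ G.Adj v w ∧ G.dist s w = d₀ + x := by simp [M]
      obtain ⟨u₀, hu₀⟩ := exists_adj_dist_eq hG s (d := d₀ + x) (by rw [hv]; rfl)
      have hM0 : M.Nonempty := ⟨u₀, (hM u₀).2 hu₀⟩
      have hMc : M.card < Fintype.card V := by
        refine Finset.card_lt_univ_of_notMem (x := v) fun hvM => ?_
        exact ((hM v).1 hvM).1.ne rfl
      -- Since `v` is not its own neighbour, `M` has fewer than `n` elements; hence every phase
      -- contains the slot that suits `M`.
      have hlog : Nat.log 2 M.card < L := by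
        refine (Nat.lt_clog_iff_pow_lt (by norm_num)).2 ?_
        exact (Nat.pow_log_le_self 2 hM0.card_pos.ne').trans_lt hMc
      set j := Nat.log 2 M.card
      -- The round of phase `q + N` whose Decay probability is `2 ^ (-(j + 1))` and whose residue
      -- belongs to layer `d₀ + x`.
      set r := 3 * ((q + N) * L + j) + (d₀ + x) % 3
      have hmod : (d₀ + x) % 3 < 3 := Nat.mod_lt _ (by norm_num)
      have hr1 : r + 1 ≤ 3 * L * (q + (N + 1)) := by
        have : 3 * L * (q + (N + 1)) = 3 * ((q + N) * L + L) := by ring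
        rw [this]; simp only [r]; omega
      have hr0 : 3 * L * (q + N) ≤ r := by
        have : 3 * L * (q + N) = 3 * ((q + N) * L) := by ring
        rw [this]; simp only [r]; omega
      have hrB : 3 * L * (q + (N + 1)) ≤ 3 * L * (q + B) := Nat.mul_le_mul_left _ (by omega)
      have hrq : 3 * L * q ≤ 3 * L * (q + N) := Nat.mul_le_mul_left _ (by omega)
      have hdiv : r / 3 = (q + N) * L + j := by simp only [r]; omega
      have hslot : r / 3 % L = j := by
        rw [hdiv, mul_comm, Nat.mul_add_mod, Nat.mod_eq_of_lt hlog]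
      have step := h.prob_step (p := p) ⟨r, by omega⟩ (v := v) (d := d₀ + x) hv
        (hok _ _ (by omega) (by omega) (by simp only; omega) (by simp only; omega))
        (by simp only [r]; omega) hM hM0 hslot (Y := Y + 2 ^ x * (1 - (1 - p) / 32) ^ N)
        (fun u hu => (h.prob_antitone hr0 u).trans
          (ih (by omega) x (by omega) u ((hM u).1 hu).2))
      have h1 := h.prob_antitone (p := p) hr1 v
      have h2 := (h.prob_antitone (p := p) hr0 v).trans (ih (by omega) (x + 1) hx v hv)
      have h3 : (1 - (1 - (p : ℝ)) / 16) * P.real (K r v)ᶜ ≤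
          (1 - (1 - p) / 16) * (Y + 2 ^ (x + 1) * (1 - (1 - p) / 32) ^ N) :=
        mul_le_mul_of_nonneg_left h2 (by linarith)
      -- With `ε = (1-p)/32`, the closing identity is `(1-2ε) 2^(x+1) + 2ε 2^x = (1-ε) 2^(x+1)`; the
      -- two multiples of `Y` add up to `Y`.
      refine h1.trans (step.trans ?_)
      simp only
      refine (add_le_add_left h3 _).trans (le_of_eq ?_)
      ring

end Spreads

end NoisyRadio

end

/-! ### Random linear network coding as the spreading of rumours -/

noncomputable section

set_option linter.unusedSectionVars false

namespace NoisyRadio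

section Packet

variable {F : Type*} [Field F] {k l T : ℕ}

theorem sum_rlncPacket_source (c : Coin F k T) (m : Fin k → Fin l → F)
    (heard : List (Option (RLNCPacket F k l))) (μ : Fin k → F) :
    ∑ i, (rlncPacket c (some m) heard).1 i * μ i = ∑ i, c.2.1 i * μ i := by
  simp [rlncPacket, Prod.fst_sum, Finset.sum_apply, Pi.single_apply]

/-- The pairing with `μ` is a linear functional of the fresh coefficients, as
`half_le_uniformOn_ne_zero` requires. -/
theorem sum_rlncPacket_relay (c : Coin F k T) (heard : List (Option (RLNCPacket F k l)))
    (μ : Fin k → F) :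
    ∑ i, (rlncPacket c none heard).1 i * μ i =
      ∑ j : Fin T, c.2.2 j * ∑ i, (((heard[(j : ℕ)]?).join).getD 0).1 i * μ i := by
  simp only [rlncPacket, Prod.fst_sum, Finset.sum_apply, Prod.smul_fst, Pi.smul_apply, smul_eq_mul,
    Finset.sum_mul, Finset.mul_sum, mul_assoc]
  exact Finset.sum_comm

/-- The packets that carry the combination of the messages `m` that their coefficients claim. -/
def validPackets (m : Fin k → Fin l → F) : Submodule F (RLNCPacket F k l) where
  carrier := {y | y.2 = ∑ i, y.1 i • m i}
  zero_mem' := by simp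
  add_mem' {x y} hx hy := by
    have hx : x.2 = ∑ i, x.1 i • m i := hx
    have hy : y.2 = ∑ i, y.1 i • m i := hy
    simp [hx, hy, add_smul, Finset.sum_add_distrib]
  smul_mem' c x hx := by
    have hx : x.2 = ∑ i, x.1 i • m i := hx
    simp [hx, mul_smul, Finset.smul_sum]

theorem mem_validPackets {m : Fin k → Fin l → F} {y : RLNCPacket F k l} :
    y ∈ validPackets m ↔ y.2 = ∑ i, y.1 i • m i := Iff.rfl

theorem rlncPacket_mem_validPackets (c : Coin F k T) {m : Fin k → Fin l → F}
    {known : Option (Fin k → Fin l → F)} (hk : ∀ m', known = some m' → m' = m)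
    {heard : List (Option (RLNCPacket F k l))} (h : ∀ y, some y ∈ heard → y ∈ validPackets m) :
    rlncPacket c known heard ∈ validPackets m := by
  cases known with
  | some m' =>
    obtain rfl := hk m' rfl
    refine Submodule.sum_mem _ fun i _ => Submodule.smul_mem _ _ ?_
    rw [mem_validPackets]
    simp [Pi.single_apply]
  | none =>
    refine Submodule.sum_mem _ fun j _ => Submodule.smul_mem _ _ ?_
    rcases hj : heard[(j : ℕ)]? with _ | _ | y
    · simp
    · simp
    · simpa using h y (List.mem_of_getElem? hj)

end Packet

section Generations

variable {V Msg P J F : Type*} [Field F] {k g l T : ℕ}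

open Classical in
/-- The packets of generation `j` in a list of packets heard. -/
def ofGeneration (gen : P → J) (lin : P → RLNCPacket F g l) (j : J) (heard : List (Option P)) :
    List (Option (RLNCPacket F g l)) :=
  heard.map fun o => o.bind fun y => if gen y = j then some (lin y) else none

theorem some_mem_ofGeneration {gen : P → J} {lin : P → RLNCPacket F g l} {j : J}
    {heard : List (Option P)} {y : RLNCPacket F g l} (h : some y ∈ ofGeneration gen lin j heard) :
    ∃ x, some x ∈ heard ∧ gen x = j ∧ lin x = y := by
  simp only [ofGeneration, List.mem_map] at h
  obtain ⟨o, ho, h⟩ := h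
  cases o with
  | none => simp at h
  | some x =>
    simp only [Option.bind_some] at h
    split_ifs at h with hx
    exact ⟨x, ho, hx, by simpa using h⟩

/-- The rule `A` by which packets are formed is random linear network coding within generations:
node `u` works on generation `gn u r` in round `r`; the messages of generation `j` are
`msgs m j`. -/
structure IsGenerationRLNC (gen : P → J) (lin : P → RLNCPacket F g l)
    (msgs : (Fin k → Msg) → J → Fin g → Fin l → F) (gn : V → ℕ → J)
    (A : V → ℕ → Coin F g T → Option (Fin k → Msg) → List (Option P) → P) : Prop where
  gen_eq : ∀ u r c known heard, gen (A u r c known heard) = gn u r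
  lin_eq : ∀ u r c known heard, lin (A u r c known heard) =
    rlncPacket c (known.map fun m => msgs m (gn u r)) (ofGeneration gen lin (gn u r) heard)

/-- What the nodes have heard before a round, when the outcome of all faults and random choices
is `ω`. -/
def run (G : SimpleGraph V) (s : V) (fm : FaultModel)
    (A : V → ℕ → Coin F g T → Option (Fin k → Msg) → List (Option P) → P)
    (dec : V → List (Option P) → Fin k → Msg) (m : Fin k → Msg) (ω : Outcome V F g T) :
    ℕ → V → List (Option P) :=
  history G s fm (decaySchedule G s A dec fun x => (ω x).2) m (extendFaults fun x => (ω x).1)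

/-- The event that `v` can tell apart messages of generation `j` that differ by `μ`. -/
def informed (G : SimpleGraph V) (s : V) (fm : FaultModel)
    (A : V → ℕ → Coin F g T → Option (Fin k → Msg) → List (Option P) → P)
    (dec : V → List (Option P) → Fin k → Msg) (m : Fin k → Msg) (gen : P → J)
    (lin : P → RLNCPacket F g l) (j : J) (μ : Fin g → F) (r : ℕ) (v : V) :
    Set (Outcome V F g T) :=
  {ω | v = s ∨ ∃ y, some y ∈ run G s fm A dec m ω r v ∧ gen y = j ∧ ∑ i, (lin y).1 i * μ i ≠ 0}

variable {G : SimpleGraph V} {s : V} {fm : FaultModel}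
  {A : V → ℕ → Coin F g T → Option (Fin k → Msg) → List (Option P) → P}
  {dec : V → List (Option P) → Fin k → Msg} {m : Fin k → Msg} {gen : P → J}
  {lin : P → RLNCPacket F g l} {msgs : (Fin k → Msg) → J → Fin g → Fin l → F} {gn : V → ℕ → J}

theorem run_congr {r : ℕ} {ω ω' : Outcome V F g T} (h : AgreeBefore r ω ω') :
    run G s fm A dec m ω r = run G s fm A dec m ω' r := by
  refine history_congr G s fm _ _ m _ _ (R := r) (fun r' hr' u => ?_) (fun r' hr' => ?_) r le_rfl
  · funext known heard
    simp only [decaySchedule]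
    split_ifs with h1 h2 h3 h3
    · rw [h _ (by exact hr')]
    · rw [h _ (by exact hr')] at h2; exact absurd h2 h3
    · rw [h _ (by exact hr')] at h2; exact absurd h3 h2
    · rfl
    · rfl
  · funext v
    simp only [extendFaults]
    split_ifs with h1
    · rw [h _ (by exact hr')]
    · rfl

-- Neighbours of `v` lie in layers `d`, `d + 1`, `d + 2`, where `d` is the layer of `u`. Of these
-- only layer `d` is active in round `r`, so `v` is silent and only that layer can collide.
open Classical in
theorem run_succ_of_transmission (hG : G.Connected) (r : Fin T) {u v : V} {ω : Outcome V F g T}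
    (ha : G.Adj v u) (hd : G.dist s v = G.dist s u + 1) (hr : r % 3 = G.dist s u % 3)
    (hu : (ω (r, u)).2.1 = true)
    (hw : ∀ w, G.Adj v w → G.dist s w = G.dist s u → w ≠ u → (ω (r, w)).2.1 = false)
    (hf : (ω (r, fm.culprit u v)).1 = false) :
    run G s fm A dec m ω (r + 1) v =
      some (A u r (ω (r, u)).2 (if u = s then some m else none) (run G s fm A dec m ω r u)) ::
        run G s fm A dec m ω r v := by
  have hv : ¬ ((r : ℕ) % 3 = G.dist s v % 3) := by omega
  rw [run, history, ← run, hear_eq_of_unique (u := u) _ _ _ _ ha]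
  · rw [if_neg (by simp [extendFaults, hf])]
    simp only [decaySchedule, Fin.is_lt, dif_pos]
    rw [if_pos ⟨hr, hu⟩]
  · simp [decaySchedule, hr, hu]
  · intro w hvw h
    simp only [decaySchedule, Fin.is_lt, dif_pos, ne_eq, ite_eq_right_iff, reduceCtorEq, imp_false,
      not_not] at h
    by_contra hne
    have h1 := dist_le_dist_add_one hG s hvw
    have h2 := dist_le_dist_add_one hG s hvw.symm
    have h3 := hw w hvw (by omega) hne
    simp [h3] at h
  · simp [decaySchedule, hv]

open Classical in
/-- The choices of coefficients by which `u` forms a packet of generation `j` whose coefficient vector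
is not orthogonal to `μ`. -/
def goodCoefficients (G : SimpleGraph V) (s : V) (fm : FaultModel)
    (A : V → ℕ → Coin F g T → Option (Fin k → Msg) → List (Option P) → P)
    (dec : V → List (Option P) → Fin k → Msg) (m : Fin k → Msg) (gen : P → J)
    (lin : P → RLNCPacket F g l) (j : J) (μ : Fin g → F) (r : ℕ) (u : V)
    (ω : Outcome V F g T) : Set ((Fin g → F) × (Fin T → F)) :=
  {z | ∑ i, z.1 i * (if u = s then μ else 0) i + ∑ t, z.2 t * (if u = s then 0 else fun t : Fin T =>
    ∑ i, ((((ofGeneration gen lin j (run G s fm A dec m ω r u))[(t : ℕ)]?).join).getD 0).1 i * μ i) t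
      ≠ 0}

theorem length_run (ω : Outcome V F g T) (r : ℕ) (v : V) :
    (run G s fm A dec m ω r v).length = r := length_history _ _ _ _ _ _ _ _

/-- At the source the functional of the coefficients is `μ` itself; at an informed relay it is
nonzero at the position of the packet that informed it. -/
theorem spreads_informed [Fintype V] [Fintype F] [MeasurableSpace F] [MeasurableSingletonClass F]
    (hG : G.Connected) (hA : IsGenerationRLNC gen lin msgs gn A) (j : J) {μ : Fin g → F}
    (hμ : μ ≠ 0) :
    Spreads G s fm (fun d r => ∀ u, G.dist s u = d → gn u r = j)
      (informed G s fm A dec m gen lin j μ) (goodCoefficients G s fm A dec m gen lin j μ) where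
  source r := Set.eq_univ_of_forall fun ω => .inl rfl
  mono r v ω := by
    rintro (h | ⟨y, hy, h⟩)
    · exact .inl h
    · exact .inr ⟨y, mem_history_succ _ _ _ hy, h⟩
  past r v ω ω' hag h := by
    unfold informed at h ⊢
    rwa [Set.mem_ofPred_eq, ← run_congr hag]
  good_past r u ω ω' hag := by
    unfold goodCoefficients
    rw [run_congr hag]
  half_le_good r u ω h := by
    classical
    refine half_le_uniformOn_ne_zero _ _ ?_
    by_cases hu : u = s
    · left; simpa [hu] using hμ
    · right
      obtain ⟨y, hy, hgen, hne⟩ := h.resolve_left hu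
      -- The history before round `r` has `r < T` entries, so each received packet has a coefficient
      -- among the `T` available.
      obtain ⟨t, ht, hyt⟩ := List.mem_iff_getElem.1 hy
      rw [length_run] at ht
      refine Function.ne_iff.2 ⟨⟨t, ht.trans r.2⟩, ?_⟩
      rw [if_neg hu]
      have : (ofGeneration gen lin j (run G s fm A dec m ω r u))[t]? = some (some (lin y)) := by
        rw [ofGeneration, List.getElem?_map, List.getElem?_eq_getElem (by rwa [length_run]), hyt]
        simp [hgen]
      simpa [this] using hne
  inform r u v ω hok ha hd hr hu hw hf hK hgood := by
    classical
    have hrun := run_succ_of_transmission (A := A) (dec := dec) (m := m) hG r ha hd hr hu hw hf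
    refine .inr ⟨_, hrun ▸ List.mem_cons_self, ?_, ?_⟩
    · rw [hA.gen_eq, hok u rfl]
    · rw [hA.lin_eq, hok u rfl]
      unfold goodCoefficients at hgood
      rw [Set.mem_ofPred_eq] at hgood
      by_cases hus : u = s
      · simp only [if_pos hus, Option.map_some, sum_rlncPacket_source]
        simpa [hus] using hgood
      · simp only [if_neg hus, Option.map_none, sum_rlncPacket_relay]
        simpa [hus] using hgood

open Classical in
theorem run_valid (hA : IsGenerationRLNC gen lin msgs gn A) (ω : Outcome V F g T) (r : ℕ) (v : V) :
    ∀ y, some y ∈ run G s fm A dec m ω r v → lin y ∈ validPackets (msgs m (gen y)) := by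
  refine forall_mem_history G s fm _ m _ _ (fun u r heard hheard y hy => ?_) r v
  simp only [decaySchedule] at hy
  split_ifs at hy <;>
  · obtain rfl := Option.some.inj hy
    rw [hA.lin_eq, hA.gen_eq]
    refine rlncPacket_mem_validPackets _ (by simp) fun y hy => ?_
    obtain ⟨x, hx, h1, h2⟩ := some_mem_ofGeneration hy
    exact h1 ▸ h2 ▸ hheard x hx

/-- If two solutions differ in coordinate `x`, their difference there is a nonzero `μ` orthogonal to
every received coefficient vector of generation `j`. -/
theorem eq_of_consistent {heard : List (Option P)} {M M' : J → Fin g → Fin l → F} {j : J}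
    (hM : ∀ y, some y ∈ heard → lin y ∈ validPackets (M (gen y)))
    (hM' : ∀ y, some y ∈ heard → lin y ∈ validPackets (M' (gen y)))
    (h : ∀ μ : Fin g → F, μ ≠ 0 → ∃ y, some y ∈ heard ∧ gen y = j ∧ ∑ i, (lin y).1 i * μ i ≠ 0) :
    M j = M' j := by
  by_contra hne
  obtain ⟨i, hi⟩ := Function.ne_iff.1 hne
  obtain ⟨x, hx⟩ := Function.ne_iff.1 hi
  obtain ⟨y, hy, hj, hsum⟩ := h (fun i => M j i x - M' j i x)
    (Function.ne_iff.2 ⟨i, by simpa [sub_eq_zero] using hx⟩)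
  have h1 := congrFun ((mem_validPackets.1 (hM y hy)).symm.trans (mem_validPackets.1 (hM' y hy))) x
  rw [hj] at h1
  refine hsum ?_
  simp only [Finset.sum_apply, Pi.smul_apply, smul_eq_mul] at h1
  simp only [mul_sub, Finset.sum_sub_distrib, h1, sub_self]

end Generations

end NoisyRadio

end

/-! ### The union bound for Decay with a single generation -/

noncomputable section

namespace NoisyRadio

theorem clog_le_three_mul_log {n : ℕ} (hn : 2 ≤ n) : (Nat.clog 2 n : ℝ) ≤ 3 * Real.log n := by
  have h1 : 2 ^ (Nat.clog 2 n).pred < n := Nat.pow_pred_clog_lt_self (by norm_num) hn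
  have hpos : 0 < Nat.clog 2 n := Nat.clog_pos (by norm_num) hn
  have h2 : ((Nat.clog 2 n : ℝ) - 1) * Real.log 2 ≤ Real.log n := by
    have h3 : ((2 : ℝ) ^ (Nat.clog 2 n - 1)) ≤ n := by exact_mod_cast h1.le
    have h4 := Real.log_le_log (by positivity) h3
    rw [Real.log_pow, Nat.cast_sub hpos] at h4
    simpa using h4
  have h3 : Real.log 2 ≤ Real.log n := Real.log_le_log (by norm_num) (by exact_mod_cast hn)
  have h4 := Real.log_two_gt_d9
  nlinarith

theorem log_max_le {n k : ℕ} (hk : 1 ≤ k) :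
    Real.log (max n k : ℕ) ≤ Real.log n + k := by
  have h1 : 0 ≤ Real.log n := Real.log_natCast_nonneg n
  have h2 : Real.log k ≤ k := (Real.log_le_sub_one_of_pos (by exact_mod_cast hk)).trans (by linarith)
  rcases max_cases n k with ⟨h, -⟩ | ⟨h, -⟩ <;> rw [h]
  · have : (0 : ℝ) ≤ k := by positivity
    linarith
  · linarith

section Union

variable {V F : Type*} [Fintype V] [Field F] [Fintype F] [MeasurableSpace F]
  [MeasurableSingletonClass F]

open Classical in
theorem prob_decayRLNC_le {G : SimpleGraph V} (hG : G.Connected) (s : V) (fm : FaultModel)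
    (p : unitInterval) {k l T : ℕ} (m : Fin k → Fin l → F) :
    (decayRLNCFailProb G s fm p T m).toReal ≤
      Fintype.card V * (Fintype.card F ^ k *
        (2 ^ G.diam * (1 - (1 - p) / 32) ^ (T / (3 * Nat.clog 2 (Fintype.card V))))) := by
  set P := outcomeLaw V p F k T
  set B := T / (3 * Nat.clog 2 (Fintype.card V))
  let gen : RLNCPacket F k l → Unit := fun _ => ()
  let A : V → ℕ → Coin F k T → Option (Fin k → Fin l → F) → List (Option (RLNCPacket F k l)) →
    RLNCPacket F k l := fun _ _ c known heard => rlncPacket c known heard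
  let dec : V → List (Option (RLNCPacket F k l)) → Fin k → Fin l → F := fun _ heard =>
    Classical.epsilon fun m : Fin k → Fin l → F => ∀ y, some y ∈ heard → y.2 = ∑ i, y.1 i • m i
  have hof : ∀ heard, ofGeneration gen id () heard = heard := by
    intro heard
    conv_rhs => rw [← List.map_id heard]
    refine List.map_congr_left fun o _ => ?_
    cases o <;> simp [gen]
  have hA : IsGenerationRLNC gen id (fun m _ => m) (fun _ _ => ()) A := by
    refine ⟨fun _ _ _ _ _ => rfl, fun u r c known heard => ?_⟩
    rw [hof]
    simp [A]
  -- The empty event at `μ = 0`, which informs nobody but the source, lets the union run over all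
  -- vectors.
  let E : V × (Fin k → F) → Set (Outcome V F k T) := fun x =>
    if x.2 = 0 then ∅ else (informed G s fm A dec m gen id () x.2 T x.1)ᶜ
  have hρ : 0 ≤ 1 - (1 - (p : ℝ)) / 32 := by linarith [p.2.1]
  have hE : ∀ x, P.real (E x) ≤ 2 ^ G.diam * (1 - (1 - p) / 32) ^ B := by
    rintro ⟨v, μ⟩
    by_cases hμ : μ = 0
    · simp only [E, if_pos hμ, measureReal_empty]
      positivity
    · simp only [E, if_neg hμ]
      have hs := spreads_informed (s := s) (fm := fm) (dec := dec) (m := m) hG hA () hμ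
      have hB : 3 * Nat.clog 2 (Fintype.card V) * (0 + B) ≤ T := by
        rw [zero_add]; exact Nat.mul_div_le _ _
      have hb := hs.prob_block (p := p) hG (q := 0) (d₀ := 0) (H := G.dist s v) (Y := 0) hB
        (fun _ _ _ _ _ _ _ _ => rfl) (fun u hu => by
          rw [hG.dist_eq_zero_iff] at hu
          rw [← hu]
          exact (hs.prob_source _).le) le_rfl B le_rfl _ le_rfl v (by simp)
      refine (hs.prob_antitone hB v).trans (hb.trans ?_)
      rw [zero_add]
      gcongr
      · norm_num
      · exact dist_le_diam hG s v
  have hsub : {ω : Outcome V F k T | ¬ Solved G s fm (decayRLNC G s l fun x => (ω x).2) m T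
      (extendFaults fun x => (ω x).1)} ⊆ ⋃ x, E x := by
    intro ω hω
    by_contra hnot
    refine hω fun v hv => ?_
    have hinf : ∀ μ : Fin k → F, μ ≠ 0 → ω ∈ informed G s fm A dec m gen id () μ T v := by
      intro μ hμ
      by_contra hc
      exact hnot (Set.mem_iUnion.2 ⟨(v, μ), by simpa [E, hμ] using hc⟩)
    have hvalid := run_valid (s := s) (G := G) (fm := fm) (dec := dec) (m := m) hA ω T v
    have hdec : ∀ y, some y ∈ run G s fm A dec m ω T v →
        y.2 = ∑ i, y.1 i • dec v (run G s fm A dec m ω T v) i :=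
      -- The true messages solve the system, so the chosen ones do too.
      Classical.epsilon_spec (p := fun m' : Fin k → Fin l → F =>
        ∀ y, some y ∈ run G s fm A dec m ω T v → y.2 = ∑ i, y.1 i • m' i) ⟨m, hvalid⟩
    exact eq_of_consistent (j := ()) (gen := gen) (lin := id)
      (M := fun _ => dec v (run G s fm A dec m ω T v)) (M' := fun _ => m) hdec hvalid
      fun μ hμ => (hinf μ hμ).resolve_left hv
  calc (decayRLNCFailProb G s fm p T m).toReal ≤ P.real (⋃ x, E x) := measureReal_mono hsub
    _ ≤ ∑ x, P.real (E x) := measureReal_iUnion_fintype_le _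
    _ ≤ ∑ _x : V × (Fin k → F), (2 : ℝ) ^ G.diam * (1 - (1 - (p : ℝ)) / 32) ^ B :=
        Finset.sum_le_sum fun x _ => hE x
    _ = _ := by
        rw [Finset.sum_const, Finset.card_univ, Fintype.card_prod, nsmul_eq_mul, Fintype.card_fun,
          Fintype.card_fin]
        push_cast
        ring

theorem exists_forall_decayRLNCFailProb_le (fm : FaultModel) (p : unitInterval) (hp : p < 1)
    (F : Type*) [Field F] [Fintype F] [MeasurableSpace F] [MeasurableSingletonClass F] :
    ∃ C : ℝ, 0 < C ∧ ∀ (V : Type u) [Fintype V] (G : SimpleGraph V) (s : V), G.Connected →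
      2 ≤ Fintype.card V → ∀ k l T : ℕ, 1 ≤ k → C * roundBound G k ≤ T →
        ∀ m : Fin k → Fin l → F,
          decayRLNCFailProb G s fm p T m ≤ ((max (Fintype.card V) k : ℕ) : ℝ≥0∞)⁻¹ := by
  have hp' : (p : ℝ) < 1 := by exact_mod_cast hp
  set ε : ℝ := (1 - p) / 32 with hε
  have hε0 : 0 < ε := by rw [hε]; linarith
  have hε1 : ε ≤ 1 := by rw [hε]; linarith [p.2.1]
  set q : ℝ := Real.log (Fintype.card F)
  have hq : 0 ≤ q := Real.log_natCast_nonneg _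
  -- A phase has `3 * L ≤ 9 * log n` rounds, so `ε (B + 1) ≥ (q + 2)(D + k + log n)`. The exponent
  -- to beat is `log n + k q + D log 2 + log (max n k)`, at most `2 log n + k (q + 1) + D log 2`;
  -- the spare `k ≥ 1 ≥ ε` pays for the incomplete phase.
  refine ⟨9 * (q + 2) / ε, by positivity, ?_⟩
  intro V _ G s hG hn k l T hk hT m
  set n := Fintype.card V
  set L := Nat.clog 2 n
  set B := T / (3 * L)
  have hL : 0 < L := Nat.clog_pos (by norm_num) hn
  have hlogn : 0 < Real.log n := Real.log_pos (by exact_mod_cast hn)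
  have hLlog : (L : ℝ) ≤ 3 * Real.log n := clog_le_three_mul_log hn
  have hB : (q + 2) / ε * (G.diam + k + Real.log n) ≤ B + 1 := by
    have h1 : T < 3 * L * (B + 1) := Nat.lt_mul_div_succ _ (by omega)
    have h2 : (T : ℝ) ≤ 3 * L * (B + 1) := by exact_mod_cast h1.le
    have h3 : (T : ℝ) ≤ 9 * Real.log n * (B + 1) := h2.trans
      (mul_le_mul_of_nonneg_right (by linarith) (by positivity))
    have h4 : 9 * Real.log n * ((q + 2) / ε * (G.diam + k + Real.log n)) ≤
        9 * Real.log n * (B + 1) := by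
      refine le_trans (le_of_eq ?_) (hT.trans h3)
      unfold roundBound
      ring
    exact le_of_mul_le_mul_left h4 (by positivity)
  have hk1 : (1 : ℝ) ≤ k := by exact_mod_cast hk
  have hmax : (0 : ℝ) < (max n k : ℕ) := by
    have : 0 < max n k := by omega
    exact_mod_cast this
  have hn0 : (0 : ℝ) < n := by positivity
  have hF0 : (0 : ℝ) < Fintype.card F := by exact_mod_cast Fintype.card_pos
  have hreal : (decayRLNCFailProb G s fm p T m).toReal ≤ ((max n k : ℕ) : ℝ)⁻¹ := by
    refine (prob_decayRLNC_le hG s fm p m).trans ?_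
    have h1 : (1 - (1 - (p : ℝ)) / 32) ^ B ≤ Real.exp (-(ε * B)) := by
      rw [← hε, mul_comm, ← mul_neg, Real.exp_nat_mul]
      exact pow_le_pow_left₀ (by linarith) (Real.one_sub_le_exp_neg ε) _
    have h2 : (n : ℝ) * (Fintype.card F ^ k * (2 ^ G.diam * (1 - (1 - (p : ℝ)) / 32) ^ B)) ≤
        n * (Fintype.card F ^ k * (2 ^ G.diam * Real.exp (-(ε * B)))) := by gcongr
    refine h2.trans ?_
    rw [← Real.exp_log hmax, ← Real.exp_neg, ← Real.exp_log hn0, ← Real.exp_log hF0,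
      ← Real.exp_log (show (0 : ℝ) < 2 by norm_num), ← Real.exp_nat_mul, ← Real.exp_nat_mul,
      ← Real.exp_add, ← Real.exp_add, ← Real.exp_add, Real.exp_le_exp]
    have h3 := log_max_le (n := n) hk
    have h4 : (q + 2) * (G.diam + k + Real.log n) ≤ ε * B + ε := by
      have := mul_le_mul_of_nonneg_left hB hε0.le
      rw [← mul_assoc, mul_div_cancel₀ _ hε0.ne'] at this
      linarith
    have h5 : (G.diam : ℝ) * Real.log 2 ≤ G.diam * 1 := by
      gcongr; linarith [Real.log_two_lt_d9]
    have h6 : 0 ≤ q * (G.diam + Real.log n) := by positivity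
    change Real.log n + (k * q + (G.diam * Real.log 2 + -(ε * B))) ≤ -Real.log (max n k : ℕ)
    have h7 : (0 : ℝ) ≤ G.diam := by positivity
    nlinarith
  rw [← ENNReal.ofReal_toReal (a := decayRLNCFailProb G s fm p T m)
    (measure_ne_top (outcomeLaw V p F k T) _)]
  refine (ENNReal.ofReal_le_ofReal hreal).trans (le_of_eq ?_)
  rw [ENNReal.ofReal_inv_of_pos hmax, ENNReal.ofReal_natCast]

end Union

end NoisyRadio

end

/-! ### Derandomisation and pipelining -/

noncomputable section

set_option linter.unusedSectionVars false

namespace NoisyRadio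

section Average

variable {V F : Type*} [Fintype V] [Field F] [Fintype F] [MeasurableSpace F]
  [MeasurableSingletonClass F] {g T : ℕ}

/-- Some random choices of the algorithm are at least as good as the average ones. -/
theorem exists_coins_le (p : unitInterval) (E : Set (Outcome V F g T)) :
    ∃ coins : Fin T × V → Coin F g T,
      Measure.pi (fun _ : Fin T × V => bernoulliMeasure true false p)
        {ω | (fun x => (ω x, coins x)) ∈ E} ≤ outcomeLaw V p F g T E := by
  have hmp := measurePreserving_arrowProdEquivProdArrow Bool (Coin F g T) (Fin T × V)
    (fun _ => bernoulliMeasure true false p)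
    (fun x => coinLaw F (Fintype.card V) g T x.1)
  set e := MeasurableEquiv.arrowProdEquivProdArrow Bool (Coin F g T) (Fin T × V)
  have h1 : outcomeLaw V p F g T E = _ := ((hmp.symm e).measure_preimage_equiv E).symm
  rw [h1, Measure.prod_apply_symm (Set.toFinite _).measurableSet]
  exact exists_le_lintegral (measurable_of_countable _).aemeasurable

end Average

section Oblivious

variable {V Msg P J F : Type*} [Field F] {k g l T : ℕ} {G : SimpleGraph V} {s : V} {fm : FaultModel}
  {A : V → ℕ → Coin F g T → Option (Fin k → Msg) → List (Option P) → P}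
  {dec : V → List (Option P) → Fin k → Msg} {gen : P → J}
  {lin : P → RLNCPacket F g l} {msgs : (Fin k → Msg) → J → Fin g → Fin l → F} {gn : V → ℕ → J}

theorem fst_join_getD (o : Option (Option (RLNCPacket F g l))) :
    (o.join.getD 0).1 = (o.map (Option.map Prod.fst)).join.getD 0 := by
  rcases o with _ | _ | y <;> simp

open Classical in
theorem map_ofGeneration (j : J) (heard : List (Option P)) :
    (ofGeneration gen lin j heard).map (Option.map Prod.fst) =
      (heard.map (Option.map fun y => (gen y, (lin y).1))).map
        fun o => o.bind fun z => if z.1 = j then some z.2 else none := by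
  rw [ofGeneration, List.map_map, List.map_map]
  refine List.map_congr_left fun o _ => ?_
  cases o with
  | none => rfl
  | some y => simp only [Function.comp, Option.bind_some, Option.map_some]; split_ifs <;> rfl

/-- The coefficients of the packets do not depend on the messages. -/
theorem run_coefficients_eq (hA : IsGenerationRLNC gen lin msgs gn A) (m m' : Fin k → Msg)
    (ω : Outcome V F g T) (r : ℕ) (v : V) :
    (run G s fm A dec m ω r v).map (Option.map fun y => (gen y, (lin y).1)) =
      (run G s fm A dec m' ω r v).map (Option.map fun y => (gen y, (lin y).1)) := by
  classical
  refine history_map_eq G s fm _ _ m m' _ _ _ (fun u r heard heard' h => ?_) r v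
  simp only [decaySchedule]
  split_ifs with h1 h2 hu
  · simp only [Option.map_some, hA.gen_eq, hA.lin_eq, rlncPacket, Prod.fst_sum, Prod.smul_fst]
  · simp only [Option.map_some, Option.map_none, hA.gen_eq, hA.lin_eq, rlncPacket, Prod.fst_sum,
      Prod.smul_fst, fst_join_getD, ← List.getElem?_map, map_ofGeneration, h]
  · rfl
  · rfl

/-- Being informed is a matter of generations and coefficients only. Hence one bad event serves all
messages, and the coins can be fixed before the messages are known. -/
theorem informed_eq (hA : IsGenerationRLNC gen lin msgs gn A) (m m' : Fin k → Msg) (j : J)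
    (μ : Fin g → F) (r : ℕ) (v : V) :
    informed G s fm A dec m gen lin j μ r v = informed G s fm A dec m' gen lin j μ r v := by
  have key : ∀ m m' ω, ω ∈ informed G s fm A dec m gen lin j μ r v →
      ω ∈ informed G s fm A dec m' gen lin j μ r v := by
    rintro m m' ω (h | ⟨y, hy, hj, hne⟩)
    · exact .inl h
    · have h1 := List.mem_map_of_mem (f := Option.map fun y => (gen y, (lin y).1)) hy
      rw [run_coefficients_eq hA m m', List.mem_map] at h1
      obtain ⟨o, ho, h1⟩ := h1
      cases o with
      | none => simp at h1
      | some y' =>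
        simp only [Option.map_some, Option.some.injEq, Prod.mk.injEq] at h1
        exact .inr ⟨y', ho, h1.1.trans hj, by rwa [h1.2]⟩
  ext ω
  exact ⟨key m m' ω, key m' m ω⟩

end Oblivious

namespace Spreads

variable {V F : Type*} [Fintype V] [Field F] [Fintype F] [MeasurableSpace F]
  [MeasurableSingletonClass F] {g T : ℕ} {G : SimpleGraph V} {s : V} {fm : FaultModel}
  {ok : ℕ → ℕ → Prop} {K : ℕ → V → Set (Outcome V F g T)}
  {good : ℕ → V → Outcome V F g T → Set ((Fin g → F) × (Fin T → F))} {p : unitInterval}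

/-- Generation `j` crosses block `i` of `H` layers in time window `j + i`, of `B` phases. Each block
adds one error term `2 ^ H * (1 - (1 - p) / 32) ^ B`. -/
theorem prob_layer (h : Spreads G s fm ok K good) (hG : G.Connected) {j B H : ℕ}
    (hok : ∀ d r, r / (3 * Nat.clog 2 (Fintype.card V) * B) = j + d / H → ok d r) :
    ∀ i, 3 * Nat.clog 2 (Fintype.card V) * (B * (j + i + 1)) ≤ T → ∀ x ≤ H, ∀ v,
      G.dist s v = i * H + x →
        (outcomeLaw V p F g T).real (K (3 * Nat.clog 2 (Fintype.card V) * (B * (j + i + 1))) v)ᶜ ≤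
          (i + 1) * (2 ^ H * (1 - (1 - p) / 32) ^ B) := by
  set L := Nat.clog 2 (Fintype.card V)
  have hρ : 0 ≤ 1 - (1 - (p : ℝ)) / 32 := by linarith [p.2.1]
  set Q : ℝ := 2 ^ H * (1 - (1 - p) / 32) ^ B
  have hQ : 0 ≤ Q := by positivity
  have block : ∀ i, 3 * L * (B * (j + i + 1)) ≤ T → ∀ Y : ℝ, 0 ≤ Y →
      (∀ u, G.dist s u = i * H →
        (outcomeLaw V p F g T).real (K (3 * L * (B * (j + i))) u)ᶜ ≤ Y) →
      ∀ x ≤ H, ∀ v, G.dist s v = i * H + x →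
        (outcomeLaw V p F g T).real (K (3 * L * (B * (j + i + 1))) v)ᶜ ≤ Y + Q := by
    intro i hi Y hY0 hY x hx v hv
    rw [show B * (j + i + 1) = B * (j + i) + B by ring] at hi ⊢
    refine (h.prob_block hG hi ?_ hY hY0 B le_rfl x hx v hv).trans ?_
    · intro d r h1 h2 h3 h4
      refine hok d r ?_
      have hd : d / H = i := by
        exact Nat.div_eq_of_lt_le h1 (by rw [Nat.succ_mul]; exact h2)
      rw [hd]
      refine Nat.div_eq_of_lt_le ?_ ?_
      · rwa [mul_comm, mul_assoc]
      · rw [mul_comm, mul_assoc]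
        convert h4 using 2
        ring
    · simp only [Q]
      gcongr
      norm_num
  intro i
  induction i with
  | zero =>
    intro hi x hx v hv
    have := block 0 hi 0 le_rfl (fun u hu => by
      rw [zero_mul, hG.dist_eq_zero_iff] at hu
      rw [← hu]
      exact (h.prob_source _).le) x hx v hv
    simpa using this
  | succ i ih =>
    intro hi x hx v hv
    have hle : 3 * L * (B * (j + i + 1)) ≤ T :=
      le_trans (Nat.mul_le_mul_left _ (Nat.mul_le_mul_left _ (by omega))) hi
    refine (block (i + 1) hi ((i + 1) * Q) (by positivity) (fun u hu => ?_) x hx v hv).trans ?_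
    -- The first layer of a block is the case `x = H` of the preceding block, which is why `x ≤ H`
    -- is allowed.
    · exact ih hle H le_rfl u (by rw [hu]; ring)
    · push_cast; linarith

theorem prob_pipeline (h : Spreads G s fm ok K good) (hG : G.Connected) {j B H : ℕ} (hH : 0 < H)
    (hok : ∀ d r, r / (3 * Nat.clog 2 (Fintype.card V) * B) = j + d / H → ok d r)
    (hT : 3 * Nat.clog 2 (Fintype.card V) * (B * (j + G.diam / H + 1)) ≤ T) (v : V) :
    (outcomeLaw V p F g T).real (K T v)ᶜ ≤
      Fintype.card V * (2 ^ H * (1 - (1 - p) / 32) ^ B) := by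
  have hρ : 0 ≤ 1 - (1 - (p : ℝ)) / 32 := by linarith [p.2.1]
  have hd := dist_le_diam hG s v
  have hdiv : G.dist s v / H ≤ G.diam / H := Nat.div_le_div_right hd
  have hT' : 3 * Nat.clog 2 (Fintype.card V) * (B * (j + G.dist s v / H + 1)) ≤ T :=
    le_trans (Nat.mul_le_mul_left _ (Nat.mul_le_mul_left _ (by omega))) hT
  refine (h.prob_antitone hT' v).trans ((h.prob_layer hG hok _ hT' (G.dist s v % H)
    (Nat.mod_lt _ hH).le v (Nat.div_add_mod' _ _).symm).trans ?_)
  gcongr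
  have h1 : G.dist s v / H ≤ G.dist s v := Nat.div_le_self _ _
  have h2 := dist_lt_card hG s v
  have h3 : G.dist s v / H + 1 ≤ Fintype.card V := by omega
  exact_mod_cast h3

end Spreads

end NoisyRadio

end

/-! ### Coding schedules with packets of `O(log (n k))` bits -/

noncomputable section

namespace NoisyRadio

/-- Bits as elements of the field with two elements. -/
def bitEquiv : Bool ≃ ZMod 2 := Fintype.equivOfCardEq (by simp [ZMod.card])

/-- Bit strings as packets that consist of the number of a generation, of coefficients for the
messages of this generation, and of a combination of these messages. -/
def wordEquiv (a n k : ℕ) : Word (a + 2) n k ≃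
    Fin (2 ^ Nat.clog 2 (n * k)) ×
      RLNCPacket (ZMod 2) (Nat.clog 2 (n * k)) (a * Nat.clog 2 (n * k)) :=
  -- `Λ` bits for the generation, `Λ` for the coefficients and `a * Λ` for the combination, hence `a
  -- + 2`; any bijection will do.
  Fintype.equivOfCardEq (by
    simp only [Fintype.card_fun, Fintype.card_fin, Fintype.card_bool, Fintype.card_prod, ZMod.card]
    ring)

/-- The messages of generation `j`, filled up with zeros. -/
def generationMessages {a n k : ℕ} (m : Fin k → Word a n k) (j : Fin (2 ^ Nat.clog 2 (n * k)))
    (x : Fin (Nat.clog 2 (n * k))) (i : Fin (a * Nat.clog 2 (n * k))) : ZMod 2 :=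
  if h : j * Nat.clog 2 (n * k) + x < k then bitEquiv (m ⟨j * Nat.clog 2 (n * k) + x, h⟩ i) else 0

section Pipeline

variable {V : Type*} [Fintype V] (G : SimpleGraph V) (s : V) (a k B : ℕ)

/-- The generation on which node `u` works in round `r`, when the generations are pipelined through
blocks of `⌈log₂ (n k)⌉` layers, `B` phases of Decay per block. -/
def pipelineGeneration (u : V) (r : ℕ) : Fin (2 ^ Nat.clog 2 (Fintype.card V * k)) :=
  -- Truncated subtraction makes layers that the pipeline has not reached work on generation `0`,
  -- which is harmless: the analysis uses only the windows `j + d / Λ`.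
  Fin.ofNat _ (r / (3 * Nat.clog 2 (Fintype.card V) * B) -
    G.dist s u / Nat.clog 2 (Fintype.card V * k))

/-- Random linear network coding within the pipelined generations. -/
def pipelineRule (T : ℕ) (u : V) (r : ℕ) (c : Coin (ZMod 2) (Nat.clog 2 (Fintype.card V * k)) T)
    (known : Option (Fin k → Word a (Fintype.card V) k))
    (heard : List (Option (Word (a + 2) (Fintype.card V) k))) :
    Word (a + 2) (Fintype.card V) k :=
  (wordEquiv a _ k).symm (pipelineGeneration G s k B u r,
    rlncPacket c (known.map fun m => generationMessages m (pipelineGeneration G s k B u r))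
      (ofGeneration (fun y => (wordEquiv a _ k y).1) (fun y => (wordEquiv a _ k y).2)
        (pipelineGeneration G s k B u r) heard))

theorem isGenerationRLNC_pipelineRule (T : ℕ) :
    IsGenerationRLNC (fun y => (wordEquiv a _ k y).1) (fun y => (wordEquiv a _ k y).2)
      generationMessages (pipelineGeneration G s k B) (pipelineRule G s a k B T) :=
  ⟨fun _ _ _ _ _ => by simp [pipelineRule], fun _ _ _ _ _ => by simp [pipelineRule]⟩

/-- Decoding by solving the linear system of each generation. -/
def pipelineDecode (n : ℕ) (heard : List (Option (Word (a + 2) n k))) (i : Fin k) : Word a n k :=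
  fun x => bitEquiv.symm ((Classical.epsilon fun M : Fin (2 ^ Nat.clog 2 (n * k)) →
      Fin (Nat.clog 2 (n * k)) → Fin (a * Nat.clog 2 (n * k)) → ZMod 2 =>
    ∀ y, some y ∈ heard → (wordEquiv a n k y).2 ∈ validPackets (M (wordEquiv a n k y).1))
      (Fin.ofNat _ (i / Nat.clog 2 (n * k)))
      ⟨i % Nat.clog 2 (n * k), Nat.mod_lt _ (Nat.pos_of_ne_zero fun h => by
        have := x.2; simp [h] at this)⟩ x)

variable {G s a k B}

-- There are `n * k * 2 ^ Λ` triples of node, message and vector, each failing with probability at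
-- most `n * 2 ^ Λ * (1 - (1 - p) / 32) ^ B`; both `n * k` and `n` are at most `2 ^ Λ`, whence the
-- fourth power.
open Classical in
theorem exists_schedule_prob_le (hG : G.Connected) (hn : 2 ≤ Fintype.card V) (hk : 1 ≤ k)
    (fm : FaultModel) (p : unitInterval) {T : ℕ}
    (hT : 3 * Nat.clog 2 (Fintype.card V) * (B * (k / Nat.clog 2 (Fintype.card V * k) +
      G.diam / Nat.clog 2 (Fintype.card V * k) + 1)) ≤ T) :
    ∃ S : CodingSchedule V k (Word a (Fintype.card V) k) (Word (a + 2) (Fintype.card V) k),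
      ∀ m, (failProb G s fm p T S m).toReal ≤
        (2 ^ Nat.clog 2 (Fintype.card V * k)) ^ 4 * (1 - (1 - p) / 32) ^ B := by
  set n := Fintype.card V
  set Λ := Nat.clog 2 (n * k)
  have hnk : 2 ≤ n * k := hn.trans (Nat.le_mul_of_pos_right _ hk)
  have hΛ : 0 < Λ := Nat.clog_pos (by norm_num) hnk
  have hpow : n * k ≤ 2 ^ Λ := Nat.le_pow_clog (by norm_num) _
  have hkpow : k ≤ 2 ^ Λ := (Nat.le_mul_of_pos_left _ (by omega)).trans hpow
  have hnpow : n ≤ 2 ^ Λ := (Nat.le_mul_of_pos_right _ hk).trans hpow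
  have hρ : 0 ≤ 1 - (1 - (p : ℝ)) / 32 := by linarith [p.2.1]
  have hA := isGenerationRLNC_pipelineRule G s a k B T
  set A := pipelineRule G s a k B T
  set gen : Word (a + 2) n k → Fin (2 ^ Λ) := fun y => (wordEquiv a n k y).1
  set lin : Word (a + 2) n k → RLNCPacket (ZMod 2) Λ (a * Λ) := fun y => (wordEquiv a n k y).2
  let dec : V → List (Option (Word (a + 2) n k)) → Fin k → Word a n k :=
    fun _ => pipelineDecode a k n
  set P := outcomeLaw V p (ZMod 2) Λ T
  -- Reference messages that define the bad event; `informed_eq` transfers it to the actual ones.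
  let m₀ : Fin k → Word a n k := fun _ _ => false
  let E : V × Fin k × (Fin Λ → ZMod 2) → Set (Outcome V (ZMod 2) Λ T) := fun x =>
    if x.2.2 = 0 then ∅
    else (informed G s fm A dec m₀ gen lin (Fin.ofNat _ (x.2.1 / Λ)) x.2.2 T x.1)ᶜ
  have hE : ∀ x, P.real (E x) ≤ n * (2 ^ Λ * (1 - (1 - p) / 32) ^ B) := by
    rintro ⟨v, i, μ⟩
    by_cases hμ : μ = 0
    · simp only [E, if_pos hμ, measureReal_empty]
      positivity
    · simp only [E, if_neg hμ]
      have hs := spreads_informed (s := s) (fm := fm) (dec := dec) (m := m₀) hG hA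
        (Fin.ofNat _ (i / Λ)) hμ
      refine hs.prob_pipeline hG hΛ (j := i / Λ) (B := B) ?_ (le_trans ?_ hT) v
      · intro d r hr u hu
        rw [pipelineGeneration, hu, hr, Nat.add_sub_cancel]
      · have : (i : ℕ) / Λ ≤ k / Λ := Nat.div_le_div_right i.2.le
        exact Nat.mul_le_mul_left _ (Nat.mul_le_mul_left _ (by omega))
  have hsum : P.real (⋃ x, E x) ≤ (2 ^ Λ) ^ 4 * (1 - (1 - p) / 32) ^ B := by
    calc P.real (⋃ x, E x) ≤ ∑ x, P.real (E x) := measureReal_iUnion_fintype_le _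
      _ ≤ ∑ _x : V × Fin k × (Fin Λ → ZMod 2), n * (2 ^ Λ * (1 - (1 - (p : ℝ)) / 32) ^ B) :=
          Finset.sum_le_sum fun x _ => hE x
      _ = (n * k : ℕ) * 2 ^ Λ * (n * (2 ^ Λ * (1 - (1 - p) / 32) ^ B)) := by
          rw [Finset.sum_const, Finset.card_univ, Fintype.card_prod, Fintype.card_prod,
            nsmul_eq_mul, Fintype.card_fun, Fintype.card_fin, Fintype.card_fin, ZMod.card]
          push_cast
          ring
      _ ≤ (2 ^ Λ : ℕ) * 2 ^ Λ * ((2 ^ Λ : ℕ) * (2 ^ Λ * (1 - (1 - p) / 32) ^ B)) := by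
          gcongr
      _ = _ := by push_cast; ring
  obtain ⟨coins, hcoins⟩ := exists_coins_le p (⋃ x, E x)
  refine ⟨decaySchedule G s A dec coins, fun m => ?_⟩
  refine le_trans (ENNReal.toReal_mono (measure_ne_top P _)
    ((measure_mono fun ω hω => ?_).trans hcoins)) hsum
  by_contra hnot
  refine hω fun v hv => ?_
  change dec v (run G s fm A dec m (fun x => (ω x, coins x)) T v) = m
  set heard := run G s fm A dec m (fun x => (ω x, coins x)) T v
  have hvalid := run_valid (s := s) (G := G) (fm := fm) (dec := dec) (m := m) hA
    (fun x => (ω x, coins x)) T v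
  have hM := Classical.epsilon_spec (p := fun M : Fin (2 ^ Λ) → Fin Λ → Fin (a * Λ) → ZMod 2 =>
    ∀ y, some y ∈ heard → lin y ∈ validPackets (M (gen y))) ⟨generationMessages m, hvalid⟩
  funext i x
  -- Generation numbers fit, so `Fin.ofNat` does not wrap around.
  have hi : (i : ℕ) / Λ < 2 ^ Λ := (Nat.div_le_self _ _).trans_lt (i.2.trans_le hkpow)
  have heq := eq_of_consistent (j := Fin.ofNat _ (i / Λ)) hM hvalid fun μ hμ => by
    have hinf : (fun x => (ω x, coins x)) ∈
        informed G s fm A dec m₀ gen lin (Fin.ofNat _ (i / Λ)) μ T v := by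
      by_contra hc
      exact hnot (Set.mem_iUnion.2 ⟨(v, i, μ), by simpa [E, hμ] using hc⟩)
    rw [informed_eq hA m₀ m] at hinf
    exact hinf.resolve_left hv
  have hidx : (Fin.ofNat (2 ^ Λ) (i / Λ) : ℕ) * Λ + i % Λ = i := by
    rw [Fin.val_ofNat, Nat.mod_eq_of_lt hi]
    exact Nat.div_add_mod' _ _
  have hx := congrFun (congrFun heq ⟨i % Λ, Nat.mod_lt _ hΛ⟩) x
  refine (congrArg bitEquiv.symm hx).trans ?_
  unfold generationMessages
  rw [dif_pos (by rw [hidx]; exact i.2), Equiv.symm_apply_apply]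
  congr 2

end Pipeline

theorem exists_schedule (fm : FaultModel) (p : unitInterval) (hp : p < 1) :
    ∃ C : ℝ, 0 < C ∧ ∀ a : ℕ, ∀ (V : Type u) [Fintype V] (G : SimpleGraph V) (s : V), G.Connected →
      2 ≤ Fintype.card V → ∀ k : ℕ, 1 ≤ k → ∃ T : ℕ, (T : ℝ) ≤ C * roundBound G k ∧
        ∃ S : CodingSchedule V k (Word a (Fintype.card V) k) (Word (a + 2) (Fintype.card V) k),
          ∀ m, failProb G s fm p T S m ≤ ((max (Fintype.card V) k : ℕ) : ℝ≥0∞)⁻¹ := by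
  have hp' : (p : ℝ) < 1 := by exact_mod_cast hp
  set ρ : ℝ := 1 - (1 - p) / 32 with hρ
  have hρ0 : 0 ≤ ρ := by rw [hρ]; linarith [p.2.1]
  -- Four of the five halvings pay for the union bound; the fifth leaves `2 ^ (-Λ) ≤ 1 / (n k)`.
  obtain ⟨c, hc⟩ := exists_pow_lt_of_lt_one (show (0 : ℝ) < (1 / 2) ^ 5 by positivity)
    (show ρ < 1 by rw [hρ]; linarith)
  have hc0 : 0 < c := by
    rcases Nat.eq_zero_or_pos c with rfl | h
    · norm_num at hc
    · exact h
  -- `3 * L ≤ 9 * log n`, and `2k + D + L ≤ 3 (k + D + log n)`.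
  refine ⟨27 * c, by positivity, ?_⟩
  intro a V _ G s hG hn k hk
  set n := Fintype.card V
  set L := Nat.clog 2 n
  set Λ := Nat.clog 2 (n * k)
  have hnk : n * k ≤ 2 ^ Λ := Nat.le_pow_clog (by norm_num) _
  obtain ⟨S, hS⟩ := exists_schedule_prob_le (s := s) (a := a) (B := c * Λ) hG hn hk fm p le_rfl
  refine ⟨3 * L * (c * Λ * (k / Λ + G.diam / Λ + 1)), ?_, S, fun m => ?_⟩
  · have hL : (L : ℝ) ≤ 3 * Real.log n := clog_le_three_mul_log hn
    have hlogn : 0 < Real.log n := Real.log_pos (by exact_mod_cast hn)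
    have h1 : Λ ≤ L + k := by
      refine Nat.clog_le_of_le_pow ?_
      rw [pow_add]
      exact Nat.mul_le_mul (Nat.le_pow_clog (by norm_num) _) Nat.lt_two_pow_self.le
    have h2 : Λ * (k / Λ + G.diam / Λ + 1) ≤ k + G.diam + Λ := by
      have := Nat.mul_div_le k Λ
      have := Nat.mul_div_le G.diam Λ
      rw [mul_add, mul_add, mul_one]
      omega
    have h3 : 3 * L * (c * Λ * (k / Λ + G.diam / Λ + 1)) ≤ 3 * L * (c * (2 * k + G.diam + L)) := by
      rw [mul_assoc c]
      exact Nat.mul_le_mul_left _ (Nat.mul_le_mul_left _ (by omega))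
    have h4 : ((3 * L * (c * Λ * (k / Λ + G.diam / Λ + 1)) : ℕ) : ℝ) ≤
        3 * L * (c * (2 * k + G.diam + L)) := by exact_mod_cast h3
    refine h4.trans ?_
    calc (3 : ℝ) * L * (c * (2 * k + G.diam + L)) ≤
        3 * (3 * Real.log n) * (c * (3 * k + 3 * G.diam + 3 * Real.log n)) := by
          have : (0 : ℝ) ≤ k := by positivity
          have : (0 : ℝ) ≤ G.diam := by positivity
          gcongr 3 * ?_ * (c * ?_)
          linarith
      _ = 27 * c * roundBound G k := by unfold roundBound; ring
  · have hmax : max n k ≤ n * k :=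
      max_le (Nat.le_mul_of_pos_right _ hk) (Nat.le_mul_of_pos_left _ (by omega))
    have hmax0 : (0 : ℝ) < (max n k : ℕ) := by
      have : 0 < max n k := by omega
      exact_mod_cast this
    have h1 : (2 ^ Λ) ^ 4 * ρ ^ (c * Λ) ≤ ((max n k : ℕ) : ℝ)⁻¹ := by
      calc (2 ^ Λ) ^ 4 * ρ ^ (c * Λ) ≤ (2 ^ Λ) ^ 4 * ((1 / 2) ^ 5) ^ Λ := by
            rw [pow_mul ρ]
            gcongr
        _ = ((2 ^ Λ : ℕ) : ℝ)⁻¹ := by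
            push_cast
            rw [← pow_mul, ← pow_mul, mul_comm 5 Λ, one_div, inv_pow, pow_mul, pow_mul _ Λ 5]
            field_simp
        _ ≤ _ := by
            gcongr
            exact hmax.trans hnk
    refine (ENNReal.ofReal_toReal (measure_ne_top _ _)).symm.trans_le ?_
    refine (ENNReal.ofReal_le_ofReal ((hS m).trans h1)).trans (le_of_eq ?_)
    rw [ENNReal.ofReal_inv_of_pos hmax0, ENNReal.ofReal_natCast]

end NoisyRadio

end

/-! ### From round bounds to throughput -/

namespace NoisyRadio

/-- Once `k ≥ D + log n`, the term `k log n` dominates and at most `2 C k log n` rounds are needed,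
so the bound holds for all large `k`. -/
theorem le_codingThroughput {V : Type*} [Fintype V] {G : SimpleGraph V} {s : V} {fm : FaultModel}
    {p : unitInterval} {a b : ℕ} {C : ℝ} (hC : 0 < C) (hn : 2 ≤ Fintype.card V)
    (h : ∀ k : ℕ, 1 ≤ k → ∃ T : ℕ, (T : ℝ) ≤ C * roundBound G k ∧
      ∃ S : CodingSchedule V k (Word a (Fintype.card V) k) (Word b (Fintype.card V) k),
        ∀ m, failProb G s fm p T S m ≤ ((max (Fintype.card V) k : ℕ) : ℝ≥0∞)⁻¹) :
    ENNReal.ofReal (1 / (2 * C) / Real.log (Fintype.card V)) ≤ codingThroughput G s fm p a b := by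
  set n := Fintype.card V
  have hlogn : 0 < Real.log n := Real.log_pos (by exact_mod_cast hn)
  refine le_limsup_of_frequently_le (Eventually.frequently ?_)
  filter_upwards [eventually_ge_atTop 1,
    tendsto_natCast_atTop_atTop.eventually_ge_atTop ((G.diam : ℝ) + Real.log n)] with k hk hkD
  obtain ⟨T, hT, S, hS⟩ := h k hk
  have hk0 : (0 : ℝ) < k := by exact_mod_cast hk
  have hmin : minLength G s fm p a b k ≤ T := by
    refine iInf₂_le T ⟨S, fun m => (hS m).trans ?_⟩
    gcongr
    exact le_max_right _ _
  have hT' : (T : ℝ) ≤ 2 * C * (k * Real.log n) := by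
    refine hT.trans ?_
    have h1 : roundBound G k ≤ 2 * (k * Real.log n) := by
      unfold roundBound
      nlinarith
    calc C * roundBound G k ≤ C * (2 * (k * Real.log n)) := by gcongr
      _ = _ := by ring
  have hT'' : (T : ℝ≥0∞) ≤ ENNReal.ofReal (2 * C * (k * Real.log n)) := by
    rw [← ENNReal.ofReal_natCast]
    exact ENNReal.ofReal_le_ofReal hT'
  calc ENNReal.ofReal (1 / (2 * C) / Real.log n)
      = ENNReal.ofReal (k / (2 * C * (k * Real.log n))) := by
        congr 1
        field_simp
    _ = k / ENNReal.ofReal (2 * C * (k * Real.log n)) := by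
        rw [ENNReal.ofReal_div_of_pos (by positivity), ENNReal.ofReal_natCast]
    _ ≤ k / minLength G s fm p a b k := ENNReal.div_le_div_left (hmin.trans hT'') _

end NoisyRadio


theorem mainTheorem10 (fm : NoisyRadio.FaultModel) (p : unitInterval) (hp : p < 1) :
    (∀ (F : Type) [Field F] [Fintype F] [MeasurableSpace F] [MeasurableSingletonClass F],
      ∃ C : ℝ, 0 < C ∧
        ∀ (V : Type u) [Fintype V] (G : SimpleGraph V) (s : V),
          G.Connected → 2 ≤ Fintype.card V →
          ∀ k l T : ℕ, 1 ≤ k → C * NoisyRadio.roundBound G k ≤ T →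
            ∀ m : Fin k → Fin l → F,
              NoisyRadio.decayRLNCFailProb G s fm p T m
                ≤ ((max (Fintype.card V) k : ℕ) : ℝ≥0∞)⁻¹) ∧
    (∃ C c : ℝ, 0 < C ∧ 0 < c ∧ ∀ a : ℕ, ∃ b : ℕ,
        ∀ (V : Type u) [Fintype V] (G : SimpleGraph V) (s : V),
          G.Connected → 2 ≤ Fintype.card V →
          (∀ k : ℕ, 1 ≤ k →
            ∃ T : ℕ, (T : ℝ) ≤ C * NoisyRadio.roundBound G k ∧
              ∃ S : NoisyRadio.CodingSchedule V k (NoisyRadio.Word a (Fintype.card V) k)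
                  (NoisyRadio.Word b (Fintype.card V) k),
                ∀ m, NoisyRadio.failProb G s fm p T S m
                  ≤ ((max (Fintype.card V) k : ℕ) : ℝ≥0∞)⁻¹) ∧
          ENNReal.ofReal (c / Real.log (Fintype.card V))
            ≤ NoisyRadio.codingThroughput G s fm p a b) := by
  refine ⟨fun F => NoisyRadio.exists_forall_decayRLNCFailProb_le fm p hp F, ?_⟩
  obtain ⟨C, hC, h⟩ := NoisyRadio.exists_schedule.{u} fm p hp
  exact ⟨C, 1 / (2 * C), hC, by positivity, fun a => ⟨a + 2, fun V _ G s hG hn =>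
    ⟨h a V G s hG hn, NoisyRadio.le_codingThroughput hC hn (h a V G s hG hn)⟩⟩⟩
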